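/- For $\tau\in\mathbb C$ with $\operatorname{Im}\tau>0$ put $q=e^{2\pi i\tau}$ and $q^s=e^{2\pi i s\tau}$, and let $$(a;q)_\infty=\prod_{k\ge0}(1-aq^k),\qquad \eta(\tau)=q^{1/24}(q;q)_\infty,$$ $$\theta_1(z|\tau)=2q^{1/8}\sum_{n\ge0}(-1)^nq^{n(n+1)/2}\sin(2n+1)z,\qquad \theta_4(z|\tau)=1+2\sum_{n\ge1}(-1)^nq^{n^2/2}\cos 2nz .$$ Let $\psi$ be the Dirichlet character modulo $10$ induced from the Legendre symbol $\left(\frac{\cdot}{5}\right)$. Then $\psi(n)=1$ if $n\equiv1,9\pmod{10}$, $\psi(n)=-1$ if $n\equiv3,7\pmod{10}$, $\psi(n)=0$ otherwise, and $\psi$ is not primitive. For every $\tau$ with $\operatorname{Im}\tau>0$ and every $z\in\mathbb C$ with $|\operatorname{Im}z|<\pi\operatorname{Im}\tau$ (the strip in which the series converges), $\theta_4(z|2\tau)\ne0$ and $$\sum_{n=1}^\infty\frac{q^n-q^{3n}-q^{7n}+q^{9n}}{1-q^{10n}}\sin 2nz=\frac{\eta^2(2\tau)\,\theta_1(2z|10\tau)\,\theta_4(z|10\tau)}{2\,\eta(10\tau)\,\theta_4(z|2\tau)}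 .$$ Moreover, for every $\tau$ with $\operatorname{Im}\tau>0$: $$\sum_{n=1}^\infty\frac{n(q^n-q^{3n}-q^{7n}+q^{9n})}{1-q^{10n}}=\sum_{n=1}^\infty\psi(n)\frac{q^n}{(1-q^n)^2}=\frac{q\,(q^2;q^2)_\infty^3(q^5;q^5)_\infty^2(q^{10};q^{10})_\infty}{(q;q)_\infty^2},$$ $$\sum_{n=1}^\infty\left(\frac n3\right)\frac{q^n-q^{3n}-q^{7n}+q^{9n}}{1-q^{10n}}=\frac{q\,(q;q)_\infty(q^6;q^6)_\infty(q^{10};q^{10})_\infty(q^{15};q^{15})_\infty}{(q^3;q^3)_\infty(q^5;q^5)_\infty},$$ $$\sum_{n=1}^\infty\left(\frac{-4}n\right)\frac{q^n-q^{3n}-q^{7n}+q^{9n}}{1-q^{10n}}=\frac{q\,(q^2;q^2)_\infty^2(q^8;q^8)_\infty(q^{20};q^{20})_\infty^4}{(q^4;q^4)_\infty^2(q^{10};q^{10})_\infty^2(q^{40};q^{40})_\infty},$$ where $\left(\frac n3\right)$ is the Legendre symbol and $\left(\frac{-4}{n}\right)$ is the Kronecker symbol ($0$ for even $n$, $(-1)^{(n-1)/2}$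 for odd $n$). All the series over $n$ converge absolutely. -/

import Mathlib

open Complex

noncomputable section

namespace LambertTheta

/-- The nome `q = exp(2πiτ)`. -/
def nome (τ : ℂ) : ℂ := cexp (2 * Real.pi * I * τ)

/-- The `q`-shifted factorial `(a; q)_∞ = ∏_{k ≥ 0} (1 - a q^k)`. -/
def qPoch (a q : ℂ) : ℂ := ∏' k : ℕ, (1 - a * q ^ k)

/-- `θ₁(z|τ) = 2 q^{1/8} ∑_{n ≥ 0} (-1)^n q^{n(n+1)/2} sin (2n+1)z`, where `q^s` means
`exp(2πisτ)`; the exponent `n(n+1)/2` is a natural number. -/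
def theta1 (z τ : ℂ) : ℂ :=
  2 * cexp (2 * Real.pi * I * τ / 8) *
    ∑' n : ℕ, (-1 : ℂ) ^ n * nome τ ^ (n * (n + 1) / 2) * Complex.sin ((2 * (n : ℂ) + 1) * z)

/-- `θ₄(z|τ) = 1 + 2 ∑_{n ≥ 1} (-1)^n q^{n²/2} cos 2nz`, where `q^{1/2}` means `exp(πiτ)`. -/
def theta4 (z τ : ℂ) : ℂ :=
  1 + 2 * ∑' n : ℕ+, (-1 : ℂ) ^ (n : ℕ) * cexp (Real.pi * I * τ) ^ ((n : ℕ) ^ 2) *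
    Complex.cos (2 * (n : ℂ) * z)

/-- The Legendre symbol `(· / 5)` as a complex Dirichlet character modulo `5`. -/
def chi5 : DirichletCharacter ℂ 5 :=
  haveI : Fact (Nat.Prime 5) := ⟨Nat.prime_five⟩
  (quadraticChar (ZMod 5)).ringHomComp (Int.castRingHom ℂ)

/-- The character modulo `10` induced from `(· / 5)`. -/
def psi10 : DirichletCharacter ℂ 10 :=
  DirichletCharacter.changeLevel (by norm_num : 5 ∣ 10) chi5

/-- The coefficient `(q^n - q^{3n} - q^{7n} + q^{9n}) / (1 - q^{10n})`. -/
def lambert10 (q : ℂ) (n : ℕ) : ℂ :=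
  (q ^ n - q ^ (3 * n) - q ^ (7 * n) + q ^ (9 * n)) / (1 - q ^ (10 * n))

end LambertTheta

end

open Complex Filter Topology

noncomputable section

namespace LambertTheta

/-! ### Infinite `q`-products: continuity, nonvanishing, dissection. -/

section QPochhammer

/-! Put x = e^{2iz} and let F(x) = ∑ c_n x^n be the bilateral series whose coefficients c_n extend
the Lambert coefficients oddly; it converges for |q| < |x| < 1/|q|, and the sine series is -(i/2)
F(x). With ϑ(x) = ∑ (-1)^n q^{5n²} x^n, multiply F by D(x) = ϑ(q⁴x) ϑ(q⁻⁴x) ϑ(q²x) ϑ(q⁻²x), which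
vanishes at q^{-s} for s = 1, 3, 7, 9, the exponents in the Lambert numerator. F D should then be an
odd theta function of degree 4, and such functions form a line.

The argument works on coefficients and never continues F. Since (1 - q^{10n}) c_n is a signed sum of
the exponentials q^{sn}, and convolving q^{sn} with the coefficients of D gives q^{sk} D(q^{-s}) =
0, the coefficients of F D satisfy the same four-step recurrence as those of D
(`IsQuasiPeriod.conv_of_hasSum_zero`). As c is odd and D is even, they are odd, hence multiples of
the coefficients of x ϑ(q⁵x²) (`eq_oddCoeff_of_isQuasiPeriod`). The constant is read off at the
simple pole x = 1/q. The Jacobi triple product, proved here from its finite form, turns D into a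
quotient of theta functions and gives `tsum_lambertCoeff_mul`.

The other evaluations are the limit z → 0 and the points z = π/3, π/4, where the triple product
collapses into eta-type products. The series over ψ is the z → 0 series with a double sum taken in
the other order. -/

lemma summable_norm_mul_pow (a : ℂ) {q : ℂ} (hq : ‖q‖ < 1) :
    Summable fun k : ℕ => ‖-(a * q ^ k)‖ := by
  simp only [norm_neg, norm_mul, norm_pow]
  exact (summable_geometric_of_lt_one (norm_nonneg _) hq).mul_left _

lemma multipliable_qPoch (a : ℂ) {q : ℂ} (hq : ‖q‖ < 1) :
    Multipliable fun k : ℕ => 1 - a * q ^ k := by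
  simpa only [sub_eq_add_neg] using
    multipliable_one_add_of_summable (summable_norm_mul_pow a hq)

lemma tendsto_prod_qPoch (a : ℂ) {q : ℂ} (hq : ‖q‖ < 1) :
    Tendsto (fun n => ∏ k ∈ Finset.range n, (1 - a * q ^ k)) atTop (𝓝 (qPoch a q)) :=
  (multipliable_qPoch a hq).hasProd.tendsto_prod_nat

lemma qPoch_eq_mul (a : ℂ) {q : ℂ} (hq : ‖q‖ < 1) :
    qPoch a q = (1 - a) * qPoch (a * q) q := by
  have h1 := (tendsto_prod_qPoch a hq).comp (tendsto_add_atTop_nat 1)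
  have h2 := (tendsto_prod_qPoch (a * q) hq).const_mul (1 - a)
  refine tendsto_nhds_unique h1 (h2.congr fun n => ?_)
  simp only [Function.comp_apply, Finset.prod_range_succ', pow_zero, mul_one]
  rw [mul_comm]
  congr 1
  exact Finset.prod_congr rfl fun k _ => by ring

lemma qPoch_one {q : ℂ} (hq : ‖q‖ < 1) : qPoch 1 q = 0 := by
  rw [qPoch_eq_mul 1 hq]; simp

lemma qPoch_ne_zero {a q : ℂ} (hq : ‖q‖ < 1) (h : ∀ k : ℕ, a * q ^ k ≠ 1) :
    qPoch a q ≠ 0 := by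
  simp only [qPoch, sub_eq_add_neg]
  refine tprod_one_add_ne_zero_of_summable (fun k => ?_) (summable_norm_mul_pow a hq)
  rw [← sub_eq_add_neg, sub_ne_zero]
  exact (h k).symm

lemma qPoch_ne_zero_of_norm_lt {a q : ℂ} (hq : ‖q‖ < 1) (ha : ‖a‖ < 1) : qPoch a q ≠ 0 := by
  refine qPoch_ne_zero hq fun k h => ?_
  have h1 : ‖a * q ^ k‖ < 1 := by
    rw [norm_mul, norm_pow]
    exact (mul_le_of_le_one_right (norm_nonneg _)
      (pow_le_one₀ (norm_nonneg _) hq.le)).trans_lt ha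
  rw [h] at h1
  simp at h1

/-- The product converges locally uniformly, being dominated by a geometric series on the ball of
radius ‖a‖ + 1. This justifies the limits x → 1/q and z → 0. -/
lemma continuous_qPoch {q : ℂ} (hq : ‖q‖ < 1) : Continuous fun a => qPoch a q := by
  rw [continuous_iff_continuousAt]
  intro a
  have hs : Summable fun k : ℕ => (‖a‖ + 1) * ‖q‖ ^ k :=
    (summable_geometric_of_lt_one (norm_nonneg _) hq).mul_left _
  have h := hs.hasProdLocallyUniformlyOn_nat_one_add (K := Metric.ball (0 : ℂ) (‖a‖ + 1))
    (f := fun k b => -(b * q ^ k)) Metric.isOpen_ball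
    (.of_forall fun k b hb => by
      rw [norm_neg, norm_mul, norm_pow]
      gcongr
      simpa using (Metric.mem_ball.1 hb).le)
    (fun k => by fun_prop)
  have h2 := h.tendstoLocallyUniformlyOn_finsetRange.continuousOn
    (.of_forall fun n => by fun_prop)
  simp only [← sub_eq_add_neg] at h2
  exact h2.continuousAt (Metric.isOpen_ball.mem_nhds (by simp))

lemma norm_pow_lt_one {q : ℂ} (hq : ‖q‖ < 1) {m : ℕ} (hm : m ≠ 0) : ‖q ^ m‖ < 1 := by
  rw [norm_pow]; exact pow_lt_one₀ (norm_nonneg _) hq hm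

/-- Sort the factors by the residue of the exponent modulo m; the proof compares partial products of
length n * m. -/
lemma qPoch_eq_prod (a : ℂ) {q : ℂ} (hq : ‖q‖ < 1) {m : ℕ} (hm : m ≠ 0) :
    qPoch a q = ∏ i ∈ Finset.range m, qPoch (a * q ^ i) (q ^ m) := by
  have h1 := (tendsto_prod_qPoch a hq).comp
    (tendsto_id.atTop_mul_const' (Nat.pos_of_ne_zero hm) : Tendsto (fun n : ℕ => n * m) atTop atTop)
  have h2 := tendsto_finsetProd (Finset.range m) fun i _ =>
    tendsto_prod_qPoch (a * q ^ i) (norm_pow_lt_one hq hm)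
  refine tendsto_nhds_unique h1 (h2.congr fun n => ?_)
  simp only [Function.comp_apply]
  rw [Finset.prod_comm]
  induction n with
  | zero => simp
  | succ n ih =>
    rw [Finset.prod_range_succ, ih, Nat.succ_mul, Finset.prod_range_add]
    congr 1
    exact Finset.prod_congr rfl fun k _ => by ring

lemma qPoch_mul_neg (a : ℂ) {q : ℂ} (hq : ‖q‖ < 1) :
    qPoch a q * qPoch (-a) q = qPoch (a ^ 2) (q ^ 2) := by
  rw [qPoch, qPoch, ← (multipliable_qPoch a hq).tprod_mul (multipliable_qPoch (-a) hq), qPoch]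
  exact tprod_congr fun k => by ring

/-- Factor by factor this is (1 - t)(1 - wt)(1 - w²t) = 1 - t³. -/
lemma qPoch_mul_cube_roots (a : ℂ) {q w : ℂ} (hq : ‖q‖ < 1) (hw : w ^ 2 + w + 1 = 0) :
    qPoch a q * (qPoch (a * w) q * qPoch (a * w ^ 2) q) = qPoch (a ^ 3) (q ^ 3) := by
  rw [qPoch, qPoch, qPoch, ← (multipliable_qPoch (a * w) hq).tprod_mul (multipliable_qPoch _ hq),
    ← (multipliable_qPoch a hq).tprod_mul
      ((multipliable_qPoch (a * w) hq).mul (multipliable_qPoch _ hq)), qPoch]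
  refine tprod_congr fun k => ?_
  have hw3 : w ^ 3 = 1 := by linear_combination (w - 1) * hw
  rw [← pow_mul, mul_comm 3 k, pow_mul]
  generalize q ^ k = t
  linear_combination (-(a * t) + a ^ 2 * t ^ 2 * w) * hw - (a * t) ^ 3 * hw3

/-- `(a; a²)_∞ (a²; a²)_∞ = (a; a)_∞`. -/
lemma qPoch_self_sq {a : ℂ} (ha : ‖a‖ < 1) :
    qPoch a (a ^ 2) * qPoch (a ^ 2) (a ^ 2) = qPoch a a := by
  rw [qPoch_eq_prod a ha two_ne_zero, Finset.prod_range_succ, Finset.prod_range_one]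
  ring_nf

end QPochhammer

/-! ### The Jacobi triple product via Gaussian binomials. -/

section TripleProduct

/-- The bilateral theta series `∑_{n ∈ ℤ} (-1)^n p^{n²} x^n`. -/
def thetaSum (p x : ℂ) : ℂ := ∑' n : ℤ, (-1 : ℂ) ^ n * p ^ (n ^ 2) * x ^ n

lemma summable_norm_theta {p x : ℂ} (hp0 : p ≠ 0) (hp : ‖p‖ < 1) (hx : x ≠ 0) :
    Summable fun n : ℤ => ‖p ^ (n ^ 2) * x ^ n‖ := by
  -- Logarithms of p and x turn the terms into those of `jacobiTheta₂`, whose summability is known.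
  obtain ⟨t, rfl⟩ : ∃ t : ℂ, cexp (Real.pi * I * t) = p :=
    ⟨log p / (Real.pi * I), by
      rw [mul_div_cancel₀ _ (mul_ne_zero (by exact_mod_cast Real.pi_ne_zero) I_ne_zero),
        exp_log hp0]⟩
  obtain ⟨z, rfl⟩ : ∃ z : ℂ, cexp (2 * Real.pi * I * z) = x :=
    ⟨log x / (2 * Real.pi * I), by
      rw [mul_div_cancel₀ _ two_pi_I_ne_zero, exp_log hx]⟩
  have ht : 0 < t.im := by
    rw [norm_exp, Real.exp_lt_one_iff] at hp
    simp at hp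
    exact pos_of_mul_pos_right hp Real.pi_pos.le
  refine ((summable_jacobiTheta₂_term_iff z t).2 ht).norm.congr fun n => ?_
  rw [jacobiTheta₂_term, ← exp_int_mul, ← exp_int_mul, ← exp_add]
  congr 2
  push_cast
  ring

lemma norm_neg_one_zpow (n : ℤ) : ‖(-1 : ℂ) ^ n‖ = 1 := by simp

lemma summable_norm_thetaSum {p x : ℂ} (hp0 : p ≠ 0) (hp : ‖p‖ < 1) (hx : x ≠ 0) :
    Summable fun n : ℤ => ‖(-1 : ℂ) ^ n * p ^ (n ^ 2) * x ^ n‖ :=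
  (summable_norm_theta hp0 hp hx).congr fun n => by
    rw [mul_assoc, norm_mul (_ ^ n), norm_neg_one_zpow, one_mul]

lemma thetaSum_inv (p x : ℂ) : thetaSum p x⁻¹ = thetaSum p x := by
  rw [thetaSum, ← (Equiv.neg ℤ).tsum_eq, thetaSum]
  refine tsum_congr fun n => ?_
  simp only [Equiv.neg_apply, neg_sq, zpow_neg, inv_zpow, inv_inv]
  rw [← inv_zpow, show (-1 : ℂ)⁻¹ = -1 by norm_num]

/-- `1 / (P; P)_m`, extended by zero to negative `m`. -/
def invPoch (P : ℂ) (m : ℤ) : ℂ :=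
  if 0 ≤ m then (∏ k ∈ Finset.range m.toNat, (1 - P * P ^ k))⁻¹ else 0

lemma one_sub_pow_ne_zero {P : ℂ} (hP : ‖P‖ < 1) (k : ℕ) : 1 - P * P ^ k ≠ 0 := by
  rw [sub_ne_zero]
  intro h
  have := norm_pow_lt_one hP (Nat.succ_ne_zero k)
  rw [pow_succ', ← h] at this
  simp at this

/-- Extension by zero keeps the recursion valid at every integer: at m = 0 the factor 1 - P^m
vanishes. -/
lemma invPoch_sub_one {P : ℂ} (hP : ‖P‖ < 1) (m : ℤ) :
    invPoch P (m - 1) = (1 - P ^ m) * invPoch P m := by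
  rcases lt_trichotomy m 0 with h | rfl | h
  · rw [invPoch, invPoch, if_neg (by lia), if_neg (by lia), mul_zero]
  · simp [invPoch]
  · obtain ⟨n, rfl⟩ : ∃ n : ℕ, m = n + 1 := ⟨(m - 1).toNat, by lia⟩
    rw [invPoch, invPoch, if_pos (by lia), if_pos (by lia), show ((n : ℤ) + 1 - 1).toNat = n by lia,
      show ((n : ℤ) + 1).toNat = n + 1 by lia, Finset.prod_range_succ, mul_inv,
      show P ^ ((n : ℤ) + 1) = P * P ^ n by rw [← pow_succ']; exact_mod_cast rfl]
    have := one_sub_pow_ne_zero hP n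
    field_simp

lemma tendsto_invPoch {P : ℂ} (hP : ‖P‖ < 1) :
    Tendsto (fun n : ℕ => invPoch P n) atTop (𝓝 (qPoch P P)⁻¹) := by
  refine ((tendsto_prod_qPoch P hP).inv₀ (qPoch_ne_zero_of_norm_lt hP hP)).congr fun n => ?_
  simp [invPoch]

lemma exists_norm_invPoch_le {P : ℂ} (hP : ‖P‖ < 1) : ∃ C, ∀ m : ℤ, ‖invPoch P m‖ ≤ C := by
  obtain ⟨C, hC⟩ := (tendsto_invPoch hP).norm.bddAbove_range
  have h0 : 0 ≤ C := (norm_nonneg _).trans (hC ⟨0, rfl⟩)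
  refine ⟨C, fun m => ?_⟩
  by_cases h : 0 ≤ m
  · lift m to ℕ using h
    exact hC ⟨m, rfl⟩
  · rwa [invPoch, if_neg h, norm_zero]

/-- The Gaussian binomial coefficient `[2N, N + j]` to the base `P`. -/
def gaussBinom (P : ℂ) (N : ℕ) (j : ℤ) : ℂ :=
  (∏ k ∈ Finset.range (2 * N), (1 - P * P ^ k)) * (invPoch P (N - j) * invPoch P (N + j))

lemma exists_norm_gaussBinom_le {P : ℂ} (hP : ‖P‖ < 1) :
    ∃ C, ∀ N j, ‖gaussBinom P N j‖ ≤ C := by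
  obtain ⟨A, hA⟩ := (tendsto_prod_qPoch P hP).norm.bddAbove_range
  obtain ⟨B, hB⟩ := exists_norm_invPoch_le hP
  have hB0 : 0 ≤ B := (norm_nonneg _).trans (hB 0)
  refine ⟨A * (B * B), fun N j => ?_⟩
  rw [gaussBinom, norm_mul, norm_mul]
  have hA' := hA ⟨2 * N, rfl⟩
  have := hB (N - j)
  have := hB (N + j)
  have hA0 : 0 ≤ A := (norm_nonneg _).trans hA'
  dsimp only at hA'
  gcongr

lemma tendsto_gaussBinom {P : ℂ} (hP : ‖P‖ < 1) (j : ℤ) :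
    Tendsto (fun N => gaussBinom P N j) atTop (𝓝 (qPoch P P)⁻¹) := by
  have h1 := (tendsto_prod_qPoch P hP).comp
    (tendsto_id.const_mul_atTop' two_pos : Tendsto (fun n : ℕ => 2 * n) atTop atTop)
  have h2 : ∀ i : ℤ, Tendsto (fun N : ℕ => invPoch P (N + i)) atTop (𝓝 (qPoch P P)⁻¹) := by
    intro i
    have ht : Tendsto (fun N : ℕ => ((N : ℤ) + i).toNat) atTop atTop :=
      tendsto_atTop_atTop.2 fun b => ⟨b + i.natAbs, fun a ha => by lia⟩
    refine ((tendsto_invPoch hP).comp ht).congr' ?_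
    filter_upwards [eventually_ge_atTop i.natAbs] with N hN
    simp only [Function.comp_apply]
    rw [Int.toNat_of_nonneg (by lia)]
  have h3 := h1.mul ((h2 (-j)).mul (h2 j))
  have hne := qPoch_ne_zero_of_norm_lt hP hP
  rw [show qPoch P P * ((qPoch P P)⁻¹ * (qPoch P P)⁻¹) = (qPoch P P)⁻¹ by field_simp] at h3
  exact h3

/-- A two-step `q`-Pascal rule that keeps the binomial central. With P = p² it mirrors
multiplication by (1 - p^{2N+1}x)(1 - p^{2N+1}x⁻¹), the factors added when N grows by one. -/
lemma gaussBinom_succ {P : ℂ} (hP0 : P ≠ 0) (hP : ‖P‖ < 1) (N : ℕ) (j : ℤ) :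
    gaussBinom P (N + 1) j = (1 + P ^ (2 * N + 1)) * gaussBinom P N j +
      P ^ (N + 1 - j) * gaussBinom P N (j - 1) + P ^ (N + 1 + j) * gaussBinom P N (j + 1) := by
  have ha := invPoch_sub_one hP (N + 1 - j)
  have ha' := invPoch_sub_one hP (N - j)
  have hb := invPoch_sub_one hP (N + 1 + j)
  have hb' := invPoch_sub_one hP (N + j)
  have e : (P : ℂ) * P ^ (2 * N + 1) = P ^ (N + 1 - j) * P ^ (N + 1 + j) := by
    rw [← zpow_add₀ hP0, ← pow_succ', ← zpow_natCast]
    congr 1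
    push_cast
    ring
  have e1 : P ^ ((N : ℤ) + 1 - j) = P * P ^ ((N : ℤ) - j) := by
    rw [← zpow_one_add₀ hP0]; congr 1; ring
  have e2 : P ^ ((N : ℤ) + 1 + j) = P * P ^ ((N : ℤ) + j) := by
    rw [← zpow_one_add₀ hP0]; congr 1; ring
  have e3 : (P : ℂ) ^ (2 * N + 1) = P * (P ^ ((N : ℤ) - j) * P ^ ((N : ℤ) + j)) := by
    apply mul_left_cancel₀ hP0
    rw [e, e1, e2]
    ring
  rw [show (N : ℤ) + 1 - j - 1 = N - j by ring] at ha
  rw [show (N : ℤ) + 1 + j - 1 = N + j by ring] at hb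
  rw [ha] at ha'
  rw [hb] at hb'
  simp only [gaussBinom]
  rw [show 2 * (N + 1) = 2 * N + 1 + 1 by ring, Finset.prod_range_succ, Finset.prod_range_succ]
  push_cast
  rw [show (N : ℤ) - (j - 1) = N + 1 - j by ring, show (N : ℤ) + (j - 1) = N + j - 1 by ring,
    show (N : ℤ) - (j + 1) = N - j - 1 by ring, show (N : ℤ) + (j + 1) = N + 1 + j by ring,
    ha, hb, ha', hb', ← pow_succ', e3, e1, e2]
  ring

lemma summable_gaussBinom {p x : ℂ} (hp0 : p ≠ 0) (hp : ‖p‖ < 1) (hx : x ≠ 0) (N : ℕ) :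
    Summable fun j : ℤ => (-1 : ℂ) ^ j * p ^ (j ^ 2) * x ^ j * gaussBinom (p ^ 2) N j := by
  obtain ⟨C, hC⟩ := exists_norm_gaussBinom_le (norm_pow_lt_one hp two_ne_zero)
  refine Summable.of_norm_bounded ((summable_norm_thetaSum hp0 hp hx).mul_right C) fun j => ?_
  rw [norm_mul]
  gcongr
  exact hC N j

lemma finite_triple_product {p x : ℂ} (hp0 : p ≠ 0) (hp : ‖p‖ < 1) (hx : x ≠ 0) (N : ℕ) :
    (∏ k ∈ Finset.range N, (1 - p * x * (p ^ 2) ^ k)) *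
      ∏ k ∈ Finset.range N, (1 - p * x⁻¹ * (p ^ 2) ^ k) =
      ∑' j : ℤ, (-1 : ℂ) ^ j * p ^ (j ^ 2) * x ^ j * gaussBinom (p ^ 2) N j := by
  induction N with
  | zero =>
    rw [tsum_eq_single 0]
    · simp [gaussBinom, invPoch]
    · intro j hj
      have : gaussBinom (p ^ 2) 0 j = 0 := by
        rcases lt_or_gt_of_ne hj with h | h
        · simp [gaussBinom, invPoch, h]
        · simp [gaussBinom, invPoch, h]
      rw [this, mul_zero]
  | succ N ih =>
    set f : ℤ → ℂ := fun j => (-1 : ℂ) ^ j * p ^ (j ^ 2) * x ^ j * gaussBinom (p ^ 2) N j with hf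
    have hs : Summable f := summable_gaussBinom hp0 hp hx N
    have h1 : HasSum (fun j => f (j - 1)) (∑' j, f j) :=
      (Equiv.subRight (1 : ℤ)).hasSum_iff (f := f) |>.2 hs.hasSum
    have h2 : HasSum (fun j => f (j + 1)) (∑' j, f j) :=
      (Equiv.addRight (1 : ℤ)).hasSum_iff (f := f) |>.2 hs.hasSum
    have h3 := ((hs.hasSum.mul_left (1 + (p ^ 2) ^ (2 * N + 1))).sub
      (h1.mul_left (x * p ^ (2 * N + 1)))).sub (h2.mul_left (x⁻¹ * p ^ (2 * N + 1)))
    have hp2 : p ^ 2 ≠ 0 := pow_ne_zero 2 hp0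
    have h4 : (fun j : ℤ => (-1 : ℂ) ^ j * p ^ (j ^ 2) * x ^ j * gaussBinom (p ^ 2) (N + 1) j) =
        fun j => (1 + (p ^ 2) ^ (2 * N + 1)) * f j - x * p ^ (2 * N + 1) * f (j - 1) -
          x⁻¹ * p ^ (2 * N + 1) * f (j + 1) := by
      funext j
      rw [gaussBinom_succ hp2 (norm_pow_lt_one hp two_ne_zero)]
      simp only [hf]
      have hm : (-1 : ℂ) ≠ 0 := by norm_num
      have e1 : (p ^ 2) ^ ((N : ℤ) + 1 - j) * p ^ (j ^ 2) =
          p ^ (2 * N + 1) * p ^ ((j - 1) ^ 2) := by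
        rw [← zpow_natCast, ← zpow_natCast, ← zpow_mul, ← zpow_add₀ hp0, ← zpow_add₀ hp0]
        congr 1; push_cast; ring
      have e2 : (p ^ 2) ^ ((N : ℤ) + 1 + j) * p ^ (j ^ 2) =
          p ^ (2 * N + 1) * p ^ ((j + 1) ^ 2) := by
        rw [← zpow_natCast, ← zpow_natCast, ← zpow_mul, ← zpow_add₀ hp0, ← zpow_add₀ hp0]
        congr 1; push_cast; ring
      rw [zpow_sub_one₀ hm, zpow_add_one₀ hm, zpow_sub_one₀ hx, zpow_add_one₀ hx]
      have e3 : x * x⁻¹ = 1 := mul_inv_cancel₀ hx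
      rw [show ((-1 : ℂ))⁻¹ = -1 by norm_num]
      generalize gaussBinom (p ^ 2) N (j - 1) = G₁ at *
      generalize gaussBinom (p ^ 2) N (j + 1) = G₂ at *
      generalize (p ^ 2) ^ ((N : ℤ) + 1 - j) = P₁ at *
      generalize (p ^ 2) ^ ((N : ℤ) + 1 + j) = P₂ at *
      linear_combination (-1 : ℂ) ^ j * x ^ j * G₁ * e1 +
        (-1 : ℂ) ^ j * x ^ j * G₂ * e2 -
        (-1 : ℂ) ^ j * x ^ j * (p ^ (2 * N + 1) * p ^ ((j - 1) ^ 2) * G₁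
          + p ^ (2 * N + 1) * p ^ ((j + 1) ^ 2) * G₂) * e3
    rw [h4, h3.tsum_eq, ← ih, Finset.prod_range_succ, Finset.prod_range_succ]
    have e3 : x * x⁻¹ = 1 := mul_inv_cancel₀ hx
    generalize ∏ k ∈ Finset.range N, (1 - p * x * (p ^ 2) ^ k) = A
    generalize ∏ k ∈ Finset.range N, (1 - p * x⁻¹ * (p ^ 2) ^ k) = B
    rw [← pow_mul, ← pow_mul]
    linear_combination (A * B * p ^ (2 * (2 * N + 1))) * e3

/-- The Jacobi triple product identity. -/
theorem thetaSum_eq_qPoch {p x : ℂ} (hp0 : p ≠ 0) (hp : ‖p‖ < 1) (hx : x ≠ 0) :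
    thetaSum p x =
      qPoch (p ^ 2) (p ^ 2) * qPoch (p * x) (p ^ 2) * qPoch (p * x⁻¹) (p ^ 2) := by
  have hP := norm_pow_lt_one hp two_ne_zero
  obtain ⟨C, hC⟩ := exists_norm_gaussBinom_le hP
  have h1 := (tendsto_prod_qPoch (p * x) hP).mul (tendsto_prod_qPoch (p * x⁻¹) hP)
  simp only [finite_triple_product hp0 hp hx] at h1
  -- Tannery's theorem: the binomials are bounded uniformly in N and j, and each tends to 1/(p²;
  -- p²)_∞.
  have h2 := tendsto_tsum_of_dominated_convergence (𝓕 := atTop)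
    ((summable_norm_thetaSum hp0 hp hx).mul_right C)
    (fun j => (tendsto_gaussBinom hP j).const_mul ((-1 : ℂ) ^ j * p ^ (j ^ 2) * x ^ j))
    (.of_forall fun N j => by
      rw [norm_mul]
      gcongr
      exact hC N j)
  have h3 := tendsto_nhds_unique h1 h2
  rw [tsum_mul_right, eq_mul_inv_iff_mul_eq₀ (qPoch_ne_zero_of_norm_lt hP hP)] at h3
  rw [thetaSum, ← h3]
  ring

end TripleProduct

/-! ### Convolution of Laurent coefficients and quasi-periods. -/

section Convolution

/-- The convolution of two bilateral sequences. -/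
def conv (a b : ℤ → ℂ) (k : ℤ) : ℂ := ∑' n : ℤ, a n * b (k - n)

/-- The change of variables `(k, n) ↦ (n, k - n)`. -/
def convEquiv : ℤ × ℤ ≃ ℤ × ℤ where
  toFun z := (z.2, z.1 - z.2)
  invFun z := (z.1 + z.2, z.1)
  left_inv z := by simp
  right_inv z := by simp

variable {a b : ℤ → ℂ} {x : ℂ}

lemma conv_term (hx : x ≠ 0) (k n : ℤ) :
    a n * x ^ n * (b (k - n) * x ^ (k - n)) = a n * b (k - n) * x ^ k := by
  rw [zpow_sub₀ hx]
  field_simp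

lemma summable_norm_conv_prod (hx : x ≠ 0) (ha : Summable fun n => ‖a n * x ^ n‖)
    (hb : Summable fun n => ‖b n * x ^ n‖) :
    Summable fun z : ℤ × ℤ => ‖a z.2 * b (z.1 - z.2) * x ^ z.1‖ := by
  refine (convEquiv.summable_iff.2 (summable_mul_of_summable_norm ha hb).norm).congr fun z => ?_
  simp only [Function.comp_apply, convEquiv, Equiv.coe_fn_mk]
  rw [conv_term hx]

lemma summable_norm_conv (hx : x ≠ 0) (ha : Summable fun n => ‖a n * x ^ n‖)
    (hb : Summable fun n => ‖b n * x ^ n‖) : Summable fun k => ‖conv a b k * x ^ k‖ := by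
  have h := summable_norm_conv_prod hx ha hb
  refine Summable.of_nonneg_of_le (fun _ => norm_nonneg _) (fun k => ?_) h.prod
  rw [conv, ← tsum_mul_right]
  exact norm_tsum_le_tsum_norm (h.prod_factor k)

lemma summable_conv (hx : x ≠ 0) (ha : Summable fun n => ‖a n * x ^ n‖)
    (hb : Summable fun n => ‖b n * x ^ n‖) (k : ℤ) : Summable fun n => a n * b (k - n) := by
  have h := ((summable_norm_conv_prod hx ha hb).prod_factor k).of_norm.mul_right (x ^ k)⁻¹
  refine h.congr fun n => ?_
  have := zpow_ne_zero k hx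
  dsimp only
  field_simp

lemma tsum_conv (hx : x ≠ 0) (ha : Summable fun n => ‖a n * x ^ n‖)
    (hb : Summable fun n => ‖b n * x ^ n‖) :
    ∑' k, conv a b k * x ^ k = (∑' n, a n * x ^ n) * ∑' n, b n * x ^ n := by
  rw [tsum_mul_tsum_of_summable_norm ha hb, ← convEquiv.tsum_eq]
  refine Eq.trans (tsum_congr fun k => ?_)
    (convEquiv.summable_iff.2 (summable_mul_of_summable_norm ha hb)).tsum_prod.symm
  rw [conv, ← tsum_mul_right]
  exact tsum_congr fun n => (conv_term hx k n).symm

lemma conv_comm (a b : ℤ → ℂ) : conv a b = conv b a := by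
  funext k
  rw [conv, ← (Equiv.subLeft k).tsum_eq, conv]
  refine tsum_congr fun n => ?_
  simp [mul_comm]

lemma conv_neg (a b : ℤ → ℂ) (k : ℤ) :
    conv a b (-k) = conv (fun n => a (-n)) (fun n => b (-n)) k := by
  rw [conv, ← (Equiv.neg ℤ).tsum_eq, conv]
  refine tsum_congr fun n => ?_
  simp only [Equiv.neg_apply]
  congr 2
  ring

/-- A quasi-period of a bilateral sequence. -/
def IsQuasiPeriod (P : ℂ) (a : ℤ → ℂ) (α : ℂ) (m : ℤ) : Prop :=
  ∀ n, a (n + m) = α * P ^ n * a n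

/-- After shifting n by m, the two terms gain αP^n and βP^{k-n}, whose product αβP^k does not depend
on n. -/
lemma IsQuasiPeriod.conv {P α β : ℂ} {m l : ℤ} (hP : P ≠ 0) (ha : IsQuasiPeriod P a α m)
    (hb : IsQuasiPeriod P b β l) : IsQuasiPeriod P (conv a b) (α * β) (m + l) := by
  intro k
  rw [LambertTheta.conv, ← (Equiv.addRight m).tsum_eq, LambertTheta.conv, ← tsum_mul_left]
  refine tsum_congr fun n => ?_
  simp only [Equiv.coe_addRight]
  rw [ha, show k + (m + l) - (n + m) = k - n + l by ring, hb, zpow_sub₀ hP]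
  have := zpow_ne_zero n hP
  field_simp

/-- If `(1 - P ^ n) c n` is annihilated by convolution with `d`, then the convolution of `c` with
`d` inherits the quasi-period of `d`. -/
lemma IsQuasiPeriod.conv_of_hasSum_zero {P α : ℂ} {m : ℤ} (hP : P ≠ 0)
    (hb : IsQuasiPeriod P b α m) (hs : ∀ k, Summable fun n => a n * b (k - n))
    (h0 : ∀ k, HasSum (fun n => (1 - P ^ n) * a n * b (k - n)) 0) :
    IsQuasiPeriod P (LambertTheta.conv a b) α m := by
  intro k
  have h1 := (hs (k + m)).hasSum.sub ((hs k).hasSum.mul_left (α * P ^ k))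
  -- Since α P^k b(k - n) = P^n b(k + m - n), the difference is exactly the annihilated sum at k +
  -- m.
  have h2 : HasSum (fun n => a n * b (k + m - n) - α * P ^ k * (a n * b (k - n))) 0 := by
    refine (h0 (k + m)).congr_fun fun n => ?_
    rw [show k + m - n = k - n + m by ring, hb, zpow_sub₀ hP]
    have := zpow_ne_zero n hP
    field_simp
  exact sub_eq_zero.1 (h1.unique h2)

/-- The multiplier α P^n never vanishes, so the recurrence propagates zeros both ways from one
representative of each class modulo 4. -/
lemma eq_zero_of_isQuasiPeriod {P α : ℂ} (hP : P ≠ 0) (hα : α ≠ 0)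
    (ha : IsQuasiPeriod P a α 4) (h₁ : a (-1) = 0) (h₂ : a 0 = 0) (h₃ : a 1 = 0) (h₄ : a 2 = 0)
    (k : ℤ) : a k = 0 := by
  have key : ∀ r, a r = 0 → ∀ j : ℤ, a (4 * j + r) = 0 := by
    intro r hr j
    induction j using Int.induction_on with
    | zero => simpa using hr
    | succ i ih =>
      rw [show (4 * ((i : ℤ) + 1) + r) = 4 * i + r + 4 by ring, ha, ih, mul_zero]
    | pred i ih =>
      have h := ha (4 * (-(i : ℤ) - 1) + r)
      rw [show 4 * (-(i : ℤ) - 1) + r + 4 = 4 * (-(i : ℤ)) + r by ring, ih] at h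
      exact (mul_eq_zero.1 h.symm).resolve_left (mul_ne_zero hα (zpow_ne_zero _ hP))
  have hk : k = 4 * ((k + 1) / 4) + ((k + 1) % 4 - 1) := by lia
  rw [hk]
  apply key
  have : (k + 1) % 4 = 0 ∨ (k + 1) % 4 = 1 ∨ (k + 1) % 4 = 2 ∨ (k + 1) % 4 = 3 := by lia
  rcases this with h | h | h | h <;> rw [h] <;> norm_num <;> assumption

end Convolution

/-! ### Odd theta functions of degree 4 form a line. -/

section OddTheta

/-- The coefficients of the odd theta function `x ∑ (-1)^m p^{m² + m} x^{2m}`. -/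
def oddCoeff (p : ℂ) (k : ℤ) : ℂ :=
  if Odd k then (-1 : ℂ) ^ (k / 2) * p ^ ((k / 2) ^ 2 + k / 2) else 0

lemma oddCoeff_two_mul_add_one (p : ℂ) (m : ℤ) :
    oddCoeff p (2 * m + 1) = (-1 : ℂ) ^ m * p ^ (m ^ 2 + m) := by
  rw [oddCoeff, if_pos (odd_two_mul_add_one m), show (2 * m + 1) / 2 = m by lia]

lemma isQuasiPeriod_oddCoeff {p : ℂ} (hp0 : p ≠ 0) :
    IsQuasiPeriod (p ^ 2) (oddCoeff p) (p ^ 4) 4 := by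
  intro k
  rcases Int.even_or_odd' k with ⟨m, rfl | rfl⟩
  · have h : ∀ j : ℤ, oddCoeff p (2 * j) = 0 := fun j => by simp [oddCoeff]
    rw [h, show 2 * m + 4 = 2 * (m + 2) by ring, h, mul_zero]
  · rw [show 2 * m + 1 + 4 = 2 * (m + 2) + 1 by ring, oddCoeff_two_mul_add_one,
      oddCoeff_two_mul_add_one, zpow_add₀ (by norm_num : (-1 : ℂ) ≠ 0),
      ← zpow_natCast p 4, ← zpow_natCast p 2, ← zpow_mul]
    rw [show ((m + 2) ^ 2 + (m + 2)) = ((4 : ℕ) : ℤ) + ((2 : ℕ) : ℤ) * (2 * m + 1) + (m ^ 2 + m) by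
      push_cast; ring, zpow_add₀ hp0, zpow_add₀ hp0]
    norm_num
    ring

lemma tsum_oddCoeff {p x : ℂ} (hp0 : p ≠ 0) (hx : x ≠ 0) :
    ∑' k, oddCoeff p k * x ^ k = x * thetaSum p (p * x ^ 2) := by
  have hinj : Function.Injective fun m : ℤ => 2 * m + 1 := fun m n h => by
    dsimp only at h; lia
  rw [← hinj.tsum_eq, thetaSum, ← tsum_mul_left]
  · refine tsum_congr fun m => ?_
    rw [oddCoeff_two_mul_add_one, mul_zpow, zpow_add₀ hp0, zpow_add₀ hx, zpow_mul, zpow_one]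
    norm_cast
    ring
  · intro k hk
    by_contra h
    apply hk
    have : ¬ Odd k := fun ⟨m, hm⟩ => h ⟨m, hm.symm⟩
    simp [oddCoeff, this]

/-- An odd sequence with quasi-period `4` is a multiple of `oddCoeff`. -/
lemma eq_oddCoeff_of_isQuasiPeriod {p : ℂ} (hp0 : p ≠ 0) {g : ℤ → ℂ}
    (hg : IsQuasiPeriod (p ^ 2) g (p ^ 4) 4) (hodd : ∀ k, g (-k) = -g k) (k : ℤ) :
    g k = g 1 * oddCoeff p k := by
  have h0 : g 0 = 0 := by simpa [self_eq_neg] using hodd 0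
  have h2 : g 2 = 0 := by
    -- At n = -2 the multiplier p⁴(p²)^{-2} equals 1, so g 2 = g (-2) = -g 2.
    have h := hg (-2)
    rw [show (-2 : ℤ) + 4 = 2 by norm_num, hodd, ← zpow_natCast p 2, ← zpow_natCast p 4,
      ← zpow_mul, ← zpow_add₀ hp0] at h
    norm_num at h
    simpa [self_eq_neg] using h
  have hq : IsQuasiPeriod (p ^ 2) (fun k => g k - g 1 * oddCoeff p k) (p ^ 4) 4 := fun n => by
    dsimp only
    rw [hg, isQuasiPeriod_oddCoeff hp0]
    ring
  refine sub_eq_zero.1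
    (eq_zero_of_isQuasiPeriod (pow_ne_zero 2 hp0) (pow_ne_zero 4 hp0) hq ?_ ?_ ?_ ?_ k)
  · have := oddCoeff_two_mul_add_one p (-1)
    norm_num at this
    simp [this, hodd]
  · simp [oddCoeff, h0]
  · have := oddCoeff_two_mul_add_one p 0
    norm_num at this
    simp [this]
  · have : ¬ Odd (2 : ℤ) := by decide
    simp [oddCoeff, h2, this]

end OddTheta

/-! ### The denominator D, a product of four theta functions. -/

section Denominator

/-- The coefficients of `thetaSum p (a x)`. -/
def thetaCoeff (p a : ℂ) (n : ℤ) : ℂ := (-1 : ℂ) ^ n * p ^ (n ^ 2) * a ^ n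

lemma thetaCoeff_mul_zpow (p a x : ℂ) (n : ℤ) :
    thetaCoeff p a n * x ^ n = (-1 : ℂ) ^ n * p ^ (n ^ 2) * (a * x) ^ n := by
  rw [thetaCoeff, mul_zpow, mul_assoc]

lemma thetaCoeff_neg (p a : ℂ) (n : ℤ) : thetaCoeff p a (-n) = thetaCoeff p a⁻¹ n := by
  simp only [thetaCoeff, neg_sq, zpow_neg, inv_zpow]
  rw [← inv_zpow, show (-1 : ℂ)⁻¹ = -1 by norm_num]

lemma isQuasiPeriod_thetaCoeff {p a : ℂ} (hp0 : p ≠ 0) (ha : a ≠ 0) :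
    IsQuasiPeriod (p ^ 2) (thetaCoeff p a) (-(p * a)) 1 := by
  intro n
  rw [thetaCoeff, thetaCoeff, zpow_add_one₀ (by norm_num : (-1 : ℂ) ≠ 0), zpow_add_one₀ ha,
    ← zpow_natCast p 2, ← zpow_mul,
    show (n + 1) ^ 2 = n ^ 2 + ((2 : ℕ) : ℤ) * n + 1 by push_cast; ring, zpow_add₀ hp0,
    zpow_add₀ hp0, zpow_one]
  ring

/-- The coefficients of `ϑ(a x) ϑ(x / a) ϑ(b x) ϑ(x / b)`, where `ϑ = thetaSum p`. -/
def fourCoeff (p a b : ℂ) : ℤ → ℂ :=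
  conv (conv (thetaCoeff p a) (thetaCoeff p a⁻¹)) (conv (thetaCoeff p b) (thetaCoeff p b⁻¹))

variable {p a b x : ℂ}

lemma summable_norm_thetaCoeff (hp0 : p ≠ 0) (hp : ‖p‖ < 1) (ha : a ≠ 0) (hx : x ≠ 0) :
    Summable fun n => ‖thetaCoeff p a n * x ^ n‖ := by
  simp only [thetaCoeff_mul_zpow]
  exact summable_norm_thetaSum hp0 hp (mul_ne_zero ha hx)

lemma tsum_thetaCoeff (p a x : ℂ) : ∑' n, thetaCoeff p a n * x ^ n = thetaSum p (a * x) := by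
  simp only [thetaCoeff_mul_zpow]
  rfl

lemma summable_norm_fourCoeff (hp0 : p ≠ 0) (hp : ‖p‖ < 1) (ha : a ≠ 0) (hb : b ≠ 0)
    (hx : x ≠ 0) : Summable fun n => ‖fourCoeff p a b n * x ^ n‖ :=
  summable_norm_conv hx
    (summable_norm_conv hx (summable_norm_thetaCoeff hp0 hp ha hx)
      (summable_norm_thetaCoeff hp0 hp (inv_ne_zero ha) hx))
    (summable_norm_conv hx (summable_norm_thetaCoeff hp0 hp hb hx)
      (summable_norm_thetaCoeff hp0 hp (inv_ne_zero hb) hx))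

lemma tsum_fourCoeff (hp0 : p ≠ 0) (hp : ‖p‖ < 1) (ha : a ≠ 0) (hb : b ≠ 0) (hx : x ≠ 0) :
    ∑' n, fourCoeff p a b n * x ^ n =
      thetaSum p (a * x) * thetaSum p (a⁻¹ * x) * (thetaSum p (b * x) * thetaSum p (b⁻¹ * x)) := by
  have h1 := summable_norm_thetaCoeff hp0 hp ha hx
  have h2 := summable_norm_thetaCoeff hp0 hp (inv_ne_zero ha) hx
  have h3 := summable_norm_thetaCoeff hp0 hp hb hx
  have h4 := summable_norm_thetaCoeff hp0 hp (inv_ne_zero hb) hx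
  rw [fourCoeff, tsum_conv hx (summable_norm_conv hx h1 h2) (summable_norm_conv hx h3 h4),
    tsum_conv hx h1 h2, tsum_conv hx h3 h4]
  simp only [tsum_thetaCoeff]

/-- Inverting x exchanges the two factors in each pair with parameters c and c⁻¹. -/
lemma fourCoeff_neg (p a b : ℂ) (k : ℤ) : fourCoeff p a b (-k) = fourCoeff p a b k := by
  have h : ∀ c : ℂ, (fun n => conv (thetaCoeff p c) (thetaCoeff p c⁻¹) (-n)) =
      conv (thetaCoeff p c) (thetaCoeff p c⁻¹) := fun c => by
    funext n
    rw [conv_neg]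
    simp only [thetaCoeff_neg, inv_inv]
    rw [conv_comm]
  rw [fourCoeff, conv_neg, h, h]

lemma isQuasiPeriod_fourCoeff (hp0 : p ≠ 0) (ha : a ≠ 0) (hb : b ≠ 0) :
    IsQuasiPeriod (p ^ 2) (fourCoeff p a b) (p ^ 4) 4 := by
  have hP := pow_ne_zero 2 hp0
  have h := ((isQuasiPeriod_thetaCoeff hp0 ha).conv hP
    (isQuasiPeriod_thetaCoeff hp0 (inv_ne_zero ha))).conv hP
    ((isQuasiPeriod_thetaCoeff hp0 hb).conv hP (isQuasiPeriod_thetaCoeff hp0 (inv_ne_zero hb)))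
  rw [show -(p * a) * -(p * a⁻¹) * (-(p * b) * -(p * b⁻¹)) = p ^ 4 by field_simp] at h
  exact h

/-- The first factor 1 - px of the triple product vanishes at x = p⁻¹. -/
lemma thetaSum_inv_self (hp0 : p ≠ 0) (hp : ‖p‖ < 1) : thetaSum p p⁻¹ = 0 := by
  rw [thetaSum_eq_qPoch hp0 hp (inv_ne_zero hp0), mul_inv_cancel₀ hp0,
    qPoch_one (norm_pow_lt_one hp two_ne_zero)]
  ring

end Denominator

/-! ### The bilateral Lambert series and its product with D. -/

section LambertCoefficients

/-- The odd extension of `lambert10 q` to the integers. -/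
def lambertCoeff (q : ℂ) (n : ℤ) : ℂ :=
  (q ^ n - q ^ (3 * n) - q ^ (7 * n) + q ^ (9 * n)) / (1 - q ^ (10 * n))

variable {q x : ℂ}

lemma lambertCoeff_natCast (q : ℂ) (n : ℕ) : lambertCoeff q n = lambert10 q n := by
  rw [lambertCoeff, lambert10]
  norm_cast

lemma one_sub_zpow_ne_zero (hq : ‖q‖ < 1) {n : ℤ} (hn : n ≠ 0) :
    1 - q ^ n ≠ 0 := by
  rw [sub_ne_zero]
  intro h
  have h2 : ‖q‖ ^ n = 1 := by rw [← norm_zpow, ← h, norm_one]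
  exact hn ((zpow_eq_one_iff_right₀ (norm_nonneg q) hq.ne).1 h2)

/-- At n = 0 both sides vanish, so the relation holds for all n and can be summed over ℤ. -/
lemma one_sub_mul_lambertCoeff (hq : ‖q‖ < 1) (n : ℤ) :
    (1 - q ^ (10 * n)) * lambertCoeff q n =
      q ^ n - q ^ (3 * n) - q ^ (7 * n) + q ^ (9 * n) := by
  by_cases hn : n = 0
  · simp [hn]
  · rw [lambertCoeff, mul_div_cancel₀ _ (one_sub_zpow_ne_zero hq (by lia))]

/-- Multiplying through by q^{10n} swaps the exponents 1 ↔ 9 and 3 ↔ 7, which carry equal signs,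
while the denominator changes sign. -/
lemma lambertCoeff_neg (hq0 : q ≠ 0) (hq : ‖q‖ < 1) (n : ℤ) :
    lambertCoeff q (-n) = -lambertCoeff q n := by
  by_cases hn : n = 0
  · simp [hn, lambertCoeff]
  · have h1 := one_sub_mul_lambertCoeff hq n
    have h2 := one_sub_mul_lambertCoeff hq (-n)
    have h3 : 1 - q ^ (10 * n) ≠ 0 := one_sub_zpow_ne_zero hq (by lia)
    apply mul_left_cancel₀ h3
    rw [mul_neg, h1]
    have e : ∀ j i : ℤ, j + i = 10 → q ^ (10 * n) * q ^ (j * -n) = q ^ (i * n) := fun j i hji => by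
      rw [← zpow_add₀ hq0]
      congr 1
      rw [← hji]
      ring
    have e1 := e 1 9 (by norm_num)
    have e2 := e 3 7 (by norm_num)
    have e3 := e 7 3 (by norm_num)
    have e4 := e 9 1 (by norm_num)
    have e5 := e 10 0 (by norm_num)
    simp only [one_mul, zero_mul, zpow_zero] at e1 e4 e5
    linear_combination -q ^ (10 * n) * h2 - e1 + e2 + e3 - e4 - lambertCoeff q (-n) * e5

lemma norm_one_sub_pow_ge (hq : ‖q‖ < 1) {n : ℕ} (hn : n ≠ 0) : 1 - ‖q‖ ≤ ‖1 - q ^ n‖ := by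
  have h1 : ‖q ^ n‖ ≤ ‖q‖ := by
    rw [norm_pow]; exact pow_le_of_le_one (norm_nonneg _) hq.le hn
  have h2 := norm_sub_norm_le (1 : ℂ) (q ^ n)
  rw [norm_one] at h2
  linarith

lemma norm_lambert10_le (hq : ‖q‖ < 1) {n : ℕ} (hn : n ≠ 0) :
    ‖lambert10 q n‖ ≤ 4 / (1 - ‖q‖) * ‖q‖ ^ n := by
  have h0 : 0 < 1 - ‖q‖ := sub_pos.2 hq
  have e : ∀ m : ℕ, n ≤ m → ‖q ^ m‖ ≤ ‖q‖ ^ n := fun m hm => by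
    rw [norm_pow]; exact pow_le_pow_of_le_one (norm_nonneg _) hq.le hm
  rw [lambert10, norm_div, div_mul_eq_mul_div]
  refine div_le_div₀ (by positivity) ?_ h0 (norm_one_sub_pow_ge hq (by lia))
  have h1 := norm_add_le (q ^ n - q ^ (3 * n) - q ^ (7 * n)) (q ^ (9 * n))
  have h2 := norm_sub_le (q ^ n - q ^ (3 * n)) (q ^ (7 * n))
  have h3 := norm_sub_le (q ^ n) (q ^ (3 * n))
  linarith [e n le_rfl, e (3 * n) (by lia), e (7 * n) (by lia), e (9 * n) (by lia)]

lemma lambert10_zero (q : ℂ) : lambert10 q 0 = 0 := by simp [lambert10]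

lemma summable_norm_lambert10 (hq : ‖q‖ < 1) (hx : ‖q * x‖ < 1) :
    Summable fun n : ℕ => ‖lambert10 q n * x ^ n‖ := by
  refine Summable.of_nonneg_of_le (fun _ => norm_nonneg _) (fun n => ?_)
    ((summable_geometric_of_lt_one (norm_nonneg _) hx).mul_left (4 / (1 - ‖q‖)))
  have h0 : 0 < 1 - ‖q‖ := sub_pos.2 hq
  by_cases hn : n = 0
  · rw [hn, lambert10_zero, zero_mul, norm_zero]
    positivity
  · rw [norm_mul, norm_pow, norm_mul, mul_pow, ← mul_assoc]
    gcongr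
    exact norm_lambert10_le hq hn

lemma summable_norm_lambertCoeff (hq0 : q ≠ 0) (hq : ‖q‖ < 1) (hx : ‖q * x‖ < 1)
    (hx' : ‖q * x⁻¹‖ < 1) : Summable fun n => ‖lambertCoeff q n * x ^ n‖ := by
  refine Summable.of_nat_of_neg ((summable_norm_lambert10 hq hx).congr fun n => ?_)
    ((summable_norm_lambert10 hq hx').congr fun n => ?_)
  · rw [lambertCoeff_natCast, zpow_natCast]
  · rw [lambertCoeff_neg hq0 hq, lambertCoeff_natCast, zpow_neg, zpow_natCast, neg_mul, norm_neg,
      inv_pow]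

lemma hasSum_lambertCoeff (hq0 : q ≠ 0) (hq : ‖q‖ < 1) (hx : ‖q * x‖ < 1)
    (hx' : ‖q * x⁻¹‖ < 1) :
    HasSum (fun n : ℕ => lambert10 q n * (x ^ n - x⁻¹ ^ n)) (∑' n, lambertCoeff q n * x ^ n) := by
  have h := (summable_norm_lambertCoeff hq0 hq hx hx').of_norm.hasSum.nat_add_neg
  rw [show lambertCoeff q 0 = 0 by simp [lambertCoeff], zero_mul, add_zero] at h
  refine h.congr_fun fun n => ?_
  rw [lambertCoeff_neg hq0 hq, lambertCoeff_natCast, zpow_neg, zpow_natCast, inv_pow]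
  ring

/-- The product of the Lambert series with its denominator is an odd theta function. -/
lemma exists_tsum_lambertCoeff_mul (hq0 : q ≠ 0) (hq : ‖q‖ < 1) :
    ∃ c : ℂ, ∀ x : ℂ, x ≠ 0 → ‖q * x‖ < 1 → ‖q * x⁻¹‖ < 1 →
      (∑' n, lambertCoeff q n * x ^ n) *
        (thetaSum (q ^ 5) (q ^ 4 * x) * thetaSum (q ^ 5) ((q ^ 4)⁻¹ * x) *
          (thetaSum (q ^ 5) (q ^ 2 * x) * thetaSum (q ^ 5) ((q ^ 2)⁻¹ * x))) =
      c * (x * thetaSum (q ^ 5) (q ^ 5 * x ^ 2)) := by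
  have hp0 : q ^ 5 ≠ 0 := pow_ne_zero 5 hq0
  have hp : ‖q ^ 5‖ < 1 := norm_pow_lt_one hq (by norm_num)
  have ha : q ^ 4 ≠ 0 := pow_ne_zero 4 hq0
  have hb : q ^ 2 ≠ 0 := pow_ne_zero 2 hq0
  have hP : (q ^ 5) ^ 2 ≠ 0 := pow_ne_zero 2 hp0
  set d := fourCoeff (q ^ 5) (q ^ 4) (q ^ 2) with hd
  have hds : ∀ y : ℂ, y ≠ 0 → Summable fun n => ‖d n * y ^ n‖ := fun y hy =>
    summable_norm_fourCoeff hp0 hp ha hb hy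
  have hdq : IsQuasiPeriod ((q ^ 5) ^ 2) d ((q ^ 5) ^ 4) 4 := isQuasiPeriod_fourCoeff hp0 ha hb
  -- Replacing n by k - n turns the sum into q^{sk} D(q^{-s}), which is zero once one theta factor
  -- is.
  have hann : ∀ s : ℤ, thetaSum (q ^ 5) (q ^ 4 * (q ^ s)⁻¹) = 0 ∨
      thetaSum (q ^ 5) ((q ^ 4)⁻¹ * (q ^ s)⁻¹) = 0 ∨ thetaSum (q ^ 5) (q ^ 2 * (q ^ s)⁻¹) = 0 ∨
      thetaSum (q ^ 5) ((q ^ 2)⁻¹ * (q ^ s)⁻¹) = 0 → ∀ k : ℤ,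
      HasSum (fun n => q ^ (s * n) * d (k - n)) 0 := by
    intro s hs k
    have hy : (q ^ s)⁻¹ ≠ 0 := inv_ne_zero (zpow_ne_zero s hq0)
    have h1 : HasSum (fun n => d n * (q ^ s)⁻¹ ^ n) 0 := by
      have h := (hds _ hy).of_norm.hasSum
      rw [hd, tsum_fourCoeff hp0 hp ha hb hy] at h
      rcases hs with hs | hs | hs | hs <;> rw [hs] at h <;> simpa using h
    have h2 := ((Equiv.subLeft k).hasSum_iff.2 h1).mul_left (q ^ (s * k))
    rw [mul_zero] at h2
    refine h2.congr_fun fun n => ?_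
    simp only [Function.comp_apply, Equiv.subLeft_apply]
    rw [inv_zpow, ← zpow_mul, mul_sub, zpow_sub₀ hq0]
    have := zpow_ne_zero (s * k) hq0
    field_simp
  have hz := thetaSum_inv_self hp0 hp
  have hx1 : ‖q * 1‖ < 1 := by simpa
  have hc1 := summable_norm_lambertCoeff hq0 hq hx1 (by simpa)
  have hg : IsQuasiPeriod ((q ^ 5) ^ 2) (conv (lambertCoeff q) d) ((q ^ 5) ^ 4) 4 := by
    refine hdq.conv_of_hasSum_zero hP (summable_conv one_ne_zero hc1 (hds 1 one_ne_zero))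
      fun k => ?_
    -- For s = 1, 3, 7, 9 the vanishing factor has parameter q⁻⁴, q⁻², q², q⁴ respectively: its
    -- argument is then q⁻⁵.
    have e1 := hann 1 (.inr (.inl (by
      rw [← hz]; congr 1; rw [← mul_inv]; congr 1; norm_cast; ring))) k
    have e2 := hann 3 (.inr (.inr (.inr (by
      rw [← hz]; congr 1; rw [← mul_inv]; congr 1; norm_cast; ring)))) k
    have e3 := hann 7 (.inr (.inr (.inl (by
      rw [← hz]; congr 1; norm_cast; field_simp)))) k
    have e4 := hann 9 (.inl (by
      rw [← hz]; congr 1; norm_cast; field_simp)) k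
    have e := ((e1.sub e2).sub e3).add e4
    simp only [sub_zero, add_zero] at e
    refine e.congr_fun fun n => ?_
    rw [← pow_mul, ← zpow_natCast, ← zpow_mul]
    push_cast
    rw [one_sub_mul_lambertCoeff hq, one_mul]
    ring
  have hodd : ∀ k, conv (lambertCoeff q) d (-k) = -conv (lambertCoeff q) d k := fun k => by
    rw [conv_neg, conv, conv, ← tsum_neg]
    refine tsum_congr fun n => ?_
    rw [lambertCoeff_neg hq0 hq, hd, fourCoeff_neg, neg_mul]
  refine ⟨conv (lambertCoeff q) d 1, fun x hx hx1 hx2 => ?_⟩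
  rw [← tsum_fourCoeff hp0 hp ha hb hx, ← hd,
    ← tsum_conv hx (summable_norm_lambertCoeff hq0 hq hx1 hx2) (hds x hx), ← tsum_oddCoeff hp0 hx,
    ← tsum_mul_left]
  refine tsum_congr fun k => ?_
  rw [eq_oddCoeff_of_isQuasiPeriod hp0 hg hodd k, mul_assoc]

end LambertCoefficients

/-! ### The constant from the pole at 1/q, and the closed form. -/

section ClosedForm

variable {p q x : ℂ}

lemma continuousOn_thetaSum (hp0 : p ≠ 0) (hp : ‖p‖ < 1) :
    ContinuousOn (thetaSum p) {0}ᶜ := by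
  have hc := continuous_qPoch (norm_pow_lt_one hp two_ne_zero)
  have h : ContinuousOn (fun x : ℂ => qPoch (p ^ 2) (p ^ 2) * qPoch (p * x) (p ^ 2) *
      qPoch (p * x⁻¹) (p ^ 2)) {0}ᶜ := by
    refine ContinuousOn.mul (ContinuousOn.mul continuousOn_const ?_) ?_
    · exact hc.comp_continuousOn (by fun_prop)
    · exact hc.comp_continuousOn (continuousOn_const.mul continuousOn_inv₀)
  exact h.congr fun x hx => thetaSum_eq_qPoch hp0 hp hx

lemma continuousAt_thetaSum (hp0 : p ≠ 0) (hp : ‖p‖ < 1) (hx : x ≠ 0) :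
    ContinuousAt (thetaSum p) x :=
  (continuousOn_thetaSum hp0 hp).continuousAt (isOpen_compl_singleton.mem_nhds hx)

lemma thetaSum_ne_zero (hp0 : p ≠ 0) (hp : ‖p‖ < 1) (hx : x ≠ 0) (h1 : ‖p * x‖ < 1)
    (h2 : ‖p * x⁻¹‖ < 1) : thetaSum p x ≠ 0 := by
  have hP := norm_pow_lt_one hp two_ne_zero
  rw [thetaSum_eq_qPoch hp0 hp hx]
  exact mul_ne_zero (mul_ne_zero (qPoch_ne_zero_of_norm_lt hP hP)
    (qPoch_ne_zero_of_norm_lt hP h1)) (qPoch_ne_zero_of_norm_lt hP h2)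

/-- Removing the leading term q^n leaves order q^{3n}, so the remaining series stays bounded at x =
1/q. At n = 0 the difference is -1, still within the bound. -/
lemma norm_lambert10_sub_pow_le (hq : ‖q‖ < 1) (n : ℕ) :
    ‖lambert10 q n - q ^ n‖ ≤ 4 / (1 - ‖q‖) * ‖q‖ ^ (3 * n) := by
  have h0 : 0 < 1 - ‖q‖ := sub_pos.2 hq
  by_cases hn : n = 0
  · simp only [hn, lambert10_zero, pow_zero, mul_zero, mul_one, zero_sub, norm_neg, norm_one]
    rw [le_div_iff₀ h0]
    linarith [norm_nonneg q]
  · have hne : 1 - q ^ (10 * n) ≠ 0 :=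
      mod_cast one_sub_zpow_ne_zero hq (n := (10 * n : ℕ)) (by lia)
    have e : ∀ m : ℕ, 3 * n ≤ m → ‖q ^ m‖ ≤ ‖q‖ ^ (3 * n) := fun m hm => by
      rw [norm_pow]; exact pow_le_pow_of_le_one (norm_nonneg _) hq.le hm
    have h : lambert10 q n - q ^ n =
        (q ^ (11 * n) + q ^ (9 * n) - q ^ (3 * n) - q ^ (7 * n)) / (1 - q ^ (10 * n)) := by
      rw [lambert10, eq_div_iff hne, sub_mul, div_mul_cancel₀ _ hne]
      ring
    rw [h, norm_div, div_mul_eq_mul_div]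
    refine div_le_div₀ (by positivity) ?_ h0 (norm_one_sub_pow_ge hq (by lia))
    have h1 := norm_sub_le (q ^ (11 * n) + q ^ (9 * n) - q ^ (3 * n)) (q ^ (7 * n))
    have h2 := norm_sub_le (q ^ (11 * n) + q ^ (9 * n)) (q ^ (3 * n))
    have h3 := norm_add_le (q ^ (11 * n)) (q ^ (9 * n))
    linarith [e _ le_rfl, e (7 * n) (by lia), e (9 * n) (by lia), e (11 * n) (by lia)]

/-- The Lambert series has a simple pole at `q⁻¹`. -/
lemma tendsto_one_sub_mul_tsum_lambertCoeff (hq0 : q ≠ 0) (hq : ‖q‖ < 1) :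
    Tendsto (fun t : ℝ => (1 - (t : ℂ)) * ∑' n, lambertCoeff q n * (t * q⁻¹) ^ n) (𝓝[<] 1)
      (𝓝 1) := by
  have hqn : 0 < ‖q‖ := norm_pos_iff.2 hq0
  have h0 : 0 < 1 - ‖q‖ := sub_pos.2 hq
  set K := 4 / (1 - ‖q‖) with hK
  have hs2 := ((summable_geometric_of_lt_one (sq_nonneg ‖q‖)
    (pow_lt_one₀ hqn.le hq two_ne_zero)).mul_left K)
  have hs1 := ((summable_geometric_of_lt_one hqn.le hq).mul_left K)
  set M := ∑' n : ℕ, K * (‖q‖ ^ 2) ^ n + ∑' n : ℕ, K * ‖q‖ ^ n with hM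
  have key : ∀ᶠ t : ℝ in 𝓝[<] 1,
      ‖(1 - (t : ℂ)) * ∑' n, lambertCoeff q n * (t * q⁻¹) ^ n - 1‖ ≤ (1 - t) * M := by
    filter_upwards [Ioo_mem_nhdsLT hq] with t ht
    have ht0 : 0 < t := hqn.trans ht.1
    have htn : ‖(t : ℂ)‖ = t := by rw [norm_real, Real.norm_of_nonneg ht0.le]
    have htc : (t : ℂ) ≠ 0 := by exact_mod_cast ht0.ne'
    have hx1 : ‖q * (t * q⁻¹)‖ < 1 := by
      rw [mul_left_comm, mul_inv_cancel₀ hq0, mul_one, htn]; exact ht.2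
    have hx2 : ‖q * ((t : ℂ) * q⁻¹)⁻¹‖ < 1 := by
      rw [mul_inv, inv_inv, norm_mul, norm_mul, norm_inv, htn]
      have : t⁻¹ * ‖q‖ ≤ 1 := by rw [inv_mul_le_iff₀ ht0]; linarith [ht.1]
      nlinarith
    have h1 := hasSum_lambertCoeff hq0 hq hx1 hx2
    have h2 := hasSum_geometric_of_norm_lt_one (ξ := (t : ℂ)) (by rw [htn]; exact ht.2)
    have h3 : ∀ n : ℕ, ‖(lambert10 q n - q ^ n) * (t * q⁻¹) ^ n‖ ≤ K * (‖q‖ ^ 2) ^ n := fun n => by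
      rw [norm_mul]
      have hb := norm_lambert10_sub_pow_le hq n
      have hc : ‖((t : ℂ) * q⁻¹) ^ n‖ ≤ (‖q‖ ^ n)⁻¹ := by
        rw [norm_pow, norm_mul, norm_inv, htn, mul_pow, inv_pow]
        exact mul_le_of_le_one_left (by positivity) (pow_le_one₀ ht0.le ht.2.le)
      calc _ ≤ K * ‖q‖ ^ (3 * n) * (‖q‖ ^ n)⁻¹ := by gcongr
        _ = _ := by
          rw [mul_assoc]
          congr 1
          have : ‖q‖ ^ n ≠ 0 := by positivity
          field_simp
          ring
    have h4 : ∀ n : ℕ, ‖lambert10 q n * ((t : ℂ) * q⁻¹)⁻¹ ^ n‖ ≤ K * ‖q‖ ^ n := fun n => by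
      by_cases hn : n = 0
      · rw [hn, lambert10_zero, zero_mul, norm_zero]; positivity
      rw [norm_mul]
      have hc : ‖((t : ℂ) * q⁻¹)⁻¹ ^ n‖ ≤ 1 := by
        rw [norm_pow, mul_inv, inv_inv, norm_mul, norm_inv, htn]
        refine pow_le_one₀ (by positivity) ?_
        rw [inv_mul_le_iff₀ ht0]; linarith [ht.1]
      exact (mul_le_of_le_one_right (norm_nonneg _) hc).trans (norm_lambert10_le hq hn)
    have s3 := Summable.of_norm_bounded hs2 h3
    have s4 := Summable.of_norm_bounded hs1 h4
    have h5 := (h2.add s3.hasSum).sub s4.hasSum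
    -- At x = t/q the leading terms form the geometric series 1/(1 - t); the other two series are
    -- bounded uniformly in t.
    have h6 : (∑' n, lambertCoeff q n * (t * q⁻¹) ^ n) = (1 - (t : ℂ))⁻¹ +
        ∑' n : ℕ, (lambert10 q n - q ^ n) * (t * q⁻¹) ^ n -
        ∑' n : ℕ, lambert10 q n * ((t : ℂ) * q⁻¹)⁻¹ ^ n := by
      refine h1.unique (h5.congr_fun fun n => ?_)
      have : q ^ n * (t * q⁻¹) ^ n = (t : ℂ) ^ n := by
        rw [← mul_pow]; congr 1; field_simp
      linear_combination this
    have h7 : (1 - (t : ℂ)) ≠ 0 := by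
      rw [sub_ne_zero]; exact_mod_cast ht.2.ne'
    have h8 : ‖1 - (t : ℂ)‖ = 1 - t := by
      rw [← ofReal_one, ← ofReal_sub, norm_real, Real.norm_of_nonneg (by linarith [ht.2])]
    have h9 := tsum_of_norm_bounded hs2.hasSum h3
    have h10 := tsum_of_norm_bounded hs1.hasSum h4
    rw [h6, add_sub_assoc, mul_add, mul_inv_cancel₀ h7, add_sub_cancel_left, norm_mul, h8]
    refine mul_le_mul_of_nonneg_left ((norm_sub_le _ _).trans ?_) (by linarith [ht.2])
    rw [hM]
    exact add_le_add h9 h10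
  have hz : Tendsto (fun t : ℝ => (1 - t) * M) (𝓝[<] 1) (𝓝 0) := by
    have : Tendsto (fun t : ℝ => (1 - t) * M) (𝓝 1) (𝓝 ((1 - 1) * M)) :=
      Continuous.tendsto (by fun_prop) 1
    rw [sub_self, zero_mul] at this
    exact this.mono_left nhdsWithin_le_nhds
  exact tendsto_sub_nhds_zero_iff.1 (squeeze_zero_norm' key hz)

/-- The factors have exponents 6, 4, 8, 2 modulo 10; one of the two (q¹⁰; q¹⁰)_∞ supplies the
missing even class. It simplifies the constant found at the pole. -/
lemma thetaSum_mul_thetaSum_cube (hq0 : q ≠ 0) (hq : ‖q‖ < 1) :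
    thetaSum (q ^ 5) q * thetaSum (q ^ 5) (q ^ 3) =
      qPoch (q ^ 10) (q ^ 10) * qPoch (q ^ 2) (q ^ 2) := by
  have hp0 : q ^ 5 ≠ 0 := pow_ne_zero 5 hq0
  have hp : ‖q ^ 5‖ < 1 := norm_pow_lt_one hq (by norm_num)
  rw [thetaSum_eq_qPoch hp0 hp hq0, thetaSum_eq_qPoch hp0 hp (pow_ne_zero 3 hq0),
    qPoch_eq_prod (q ^ 2) (norm_pow_lt_one hq two_ne_zero) (m := 5) (by norm_num)]
  simp only [Finset.prod_range_succ, Finset.prod_range_zero]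
  rw [show q ^ 5 * q⁻¹ = q ^ 4 by field_simp, show q ^ 5 * (q ^ 3)⁻¹ = q ^ 2 by field_simp]
  ring_nf

/-- In base q¹⁰, D supplies the exponents 1, 3, 7, 9 for x and x⁻¹; ϑ(x) adds 5, completing the odd
exponents in the product for `thetaSum q x`. -/
lemma thetaSum_product (hq0 : q ≠ 0) (hq : ‖q‖ < 1) (hx : x ≠ 0) :
    thetaSum (q ^ 5) (q ^ 4 * x) * thetaSum (q ^ 5) ((q ^ 4)⁻¹ * x) *
          (thetaSum (q ^ 5) (q ^ 2 * x) * thetaSum (q ^ 5) ((q ^ 2)⁻¹ * x)) *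
      thetaSum (q ^ 5) x * qPoch (q ^ 2) (q ^ 2) =
    qPoch (q ^ 10) (q ^ 10) ^ 5 * thetaSum q x := by
  have hp0 : q ^ 5 ≠ 0 := pow_ne_zero 5 hq0
  have hp : ‖q ^ 5‖ < 1 := norm_pow_lt_one hq (by norm_num)
  have h4 : q ^ 4 ≠ 0 := pow_ne_zero 4 hq0
  have h2 : q ^ 2 ≠ 0 := pow_ne_zero 2 hq0
  have hP := norm_pow_lt_one hq two_ne_zero
  rw [thetaSum_eq_qPoch hp0 hp (mul_ne_zero h4 hx),
    thetaSum_eq_qPoch hp0 hp (mul_ne_zero (inv_ne_zero h4) hx),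
    thetaSum_eq_qPoch hp0 hp (mul_ne_zero h2 hx),
    thetaSum_eq_qPoch hp0 hp (mul_ne_zero (inv_ne_zero h2) hx),
    thetaSum_eq_qPoch hp0 hp hx, thetaSum_eq_qPoch hq0 hq hx,
    qPoch_eq_prod (q * x) hP (m := 5) (by norm_num),
    qPoch_eq_prod (q * x⁻¹) hP (m := 5) (by norm_num)]
  simp only [Finset.prod_range_succ, Finset.prod_range_zero, ← pow_mul]
  rw [show q ^ 5 * (q ^ 4 * x) = q ^ 9 * x by ring,
    show q ^ 5 * (q ^ 4 * x)⁻¹ = q * x⁻¹ by field_simp,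
    show q ^ 5 * ((q ^ 4)⁻¹ * x) = q * x by field_simp,
    show q ^ 5 * ((q ^ 4)⁻¹ * x)⁻¹ = q ^ 9 * x⁻¹ by field_simp,
    show q ^ 5 * (q ^ 2 * x) = q ^ 7 * x by ring,
    show q ^ 5 * (q ^ 2 * x)⁻¹ = q ^ 3 * x⁻¹ by field_simp,
    show q ^ 5 * ((q ^ 2)⁻¹ * x) = q ^ 3 * x by field_simp,
    show q ^ 5 * ((q ^ 2)⁻¹ * x)⁻¹ = q ^ 7 * x⁻¹ by field_simp]
  have e : ∀ y : ℂ, ∀ i j : ℕ, i + 1 = j → q * y * q ^ i = q ^ j * y := fun y i j h => by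
    rw [← h]; ring
  rw [e x _ 1 rfl, e x _ 3 rfl, e x _ 5 rfl, e x _ 7 rfl, e x _ 9 rfl, e x⁻¹ _ 1 rfl,
    e x⁻¹ _ 3 rfl, e x⁻¹ _ 5 rfl, e x⁻¹ _ 7 rfl, e x⁻¹ _ 9 rfl, pow_one]
  norm_num
  ring

/-- The Lambert series as a quotient of theta functions. -/
theorem tsum_lambertCoeff_mul (hq0 : q ≠ 0) (hq : ‖q‖ < 1) (hx : x ≠ 0) (hx1 : ‖q * x‖ < 1)
    (hx2 : ‖q * x⁻¹‖ < 1) :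
    (∑' n, lambertCoeff q n * x ^ n) * (qPoch (q ^ 10) (q ^ 10) * thetaSum q x) =
      q * qPoch (q ^ 2) (q ^ 2) ^ 2 * (x * thetaSum (q ^ 5) (q ^ 5 * x ^ 2)) *
        thetaSum (q ^ 5) x := by
  obtain ⟨c, hc⟩ := exists_tsum_lambertCoeff_mul hq0 hq
  have hp0 : q ^ 5 ≠ 0 := pow_ne_zero 5 hq0
  have hp : ‖q ^ 5‖ < 1 := norm_pow_lt_one hq (by norm_num)
  have hQ : ‖q ^ 10‖ < 1 := norm_pow_lt_one hq (by norm_num)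
  have hQ0 := qPoch_ne_zero_of_norm_lt hQ hQ
  have hqn : 0 < ‖q‖ := norm_pos_iff.2 hq0
  have h2 : ‖q ^ 2‖ < 1 := norm_pow_lt_one hq two_ne_zero
  have h3 : q ^ 3 ≠ 0 := pow_ne_zero 3 hq0
  have hc' : c = q * qPoch (q ^ 10) (q ^ 10) ^ 4 * qPoch (q ^ 2) (q ^ 2) := by
    have hx : Tendsto (fun t : ℝ => (t : ℂ) * q⁻¹) (𝓝[<] 1) (𝓝 q⁻¹) := by
      have : Tendsto (fun t : ℝ => (t : ℂ) * q⁻¹) (𝓝 1) (𝓝 (((1 : ℝ) : ℂ) * q⁻¹)) :=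
        Continuous.tendsto (by fun_prop) 1
      rw [ofReal_one, one_mul] at this
      exact this.mono_left nhdsWithin_le_nhds
    have ht : Tendsto (fun t : ℝ => (t : ℂ)) (𝓝[<] 1) (𝓝 1) := by
      have := (continuous_ofReal.tendsto (1 : ℝ)).mono_left (nhdsWithin_le_nhds (s := Set.Iio 1))
      rwa [ofReal_one] at this
    have hth : ∀ a b : ℂ, b ≠ 0 → a * q⁻¹ = b → Tendsto
        (fun t : ℝ => thetaSum (q ^ 5) (a * (t * q⁻¹))) (𝓝[<] 1) (𝓝 (thetaSum (q ^ 5) b)) :=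
      fun a b hb hab => (continuousAt_thetaSum hp0 hp hb).tendsto.comp (hab ▸ hx.const_mul a)
    have hR : Tendsto (fun t : ℝ => c * ((t * q⁻¹) * thetaSum (q ^ 5) (q ^ 5 * (t * q⁻¹) ^ 2)))
        (𝓝[<] 1) (𝓝 (c * (q⁻¹ * thetaSum (q ^ 5) (q ^ 3)))) := by
      refine (hx.mul ((continuousAt_thetaSum hp0 hp h3).tendsto.comp ?_)).const_mul c
      have := (hx.pow 2).const_mul (q ^ 5)
      rwa [show q ^ 5 * q⁻¹ ^ 2 = q ^ 3 by field_simp] at this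
    have hcp := continuous_qPoch hQ
    have hA : Tendsto (fun t : ℝ => qPoch ((t : ℂ) * q ^ 10) (q ^ 10)) (𝓝[<] 1)
        (𝓝 (qPoch (q ^ 10) (q ^ 10))) := by
      have := (hcp.tendsto _).comp (ht.mul_const (q ^ 10))
      rwa [one_mul] at this
    have hB : Tendsto (fun t : ℝ => qPoch (q ^ 10 * (t : ℂ)⁻¹) (q ^ 10)) (𝓝[<] 1)
        (𝓝 (qPoch (q ^ 10) (q ^ 10))) := by
      have := (hcp.tendsto _).comp ((ht.inv₀ one_ne_zero).const_mul (q ^ 10))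
      rwa [inv_one, mul_one] at this
    have hL := ((tendsto_one_sub_mul_tsum_lambertCoeff hq0 hq).mul
      (((hth (q ^ 4) (q ^ 3) h3 (by field_simp)).mul
        ((hA.const_mul (qPoch (q ^ 10) (q ^ 10))).mul hB)).mul
        ((hth (q ^ 2) q hq0 (by field_simp)).mul
          (hth (q ^ 2)⁻¹ (q ^ 3)⁻¹ (inv_ne_zero h3) (by field_simp)))))
    have heq := tendsto_nhds_unique (hL.congr' ?_) hR
    · rw [thetaSum_inv] at heq
      have hne : thetaSum (q ^ 5) (q ^ 3) ≠ 0 := thetaSum_ne_zero hp0 hp h3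
        (by rw [← pow_add]; exact norm_pow_lt_one hq (by norm_num))
        (by rw [show q ^ 5 * (q ^ 3)⁻¹ = q ^ 2 by field_simp]; exact h2)
      have h13 := thetaSum_mul_thetaSum_cube hq0 hq
      apply mul_right_cancel₀ (mul_ne_zero (inv_ne_zero hq0) hne)
      rw [← heq]
      have hqq : q * q⁻¹ = 1 := mul_inv_cancel₀ hq0
      linear_combination thetaSum (q ^ 5) (q ^ 3) * qPoch (q ^ 10) (q ^ 10) ^ 3 * h13 -
        qPoch (q ^ 10) (q ^ 10) ^ 4 * qPoch (q ^ 2) (q ^ 2) * thetaSum (q ^ 5) (q ^ 3) * hqq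
    · filter_upwards [Ioo_mem_nhdsLT hq] with t ht
      have ht0 : 0 < t := hqn.trans ht.1
      have htn : ‖(t : ℂ)‖ = t := by rw [norm_real, Real.norm_of_nonneg ht0.le]
      have htc : (t : ℂ) ≠ 0 := by exact_mod_cast ht0.ne'
      have hx1 : ‖q * (t * q⁻¹)‖ < 1 := by
        rw [mul_left_comm, mul_inv_cancel₀ hq0, mul_one, htn]; exact ht.2
      have hx2 : ‖q * ((t : ℂ) * q⁻¹)⁻¹‖ < 1 := by
        rw [mul_inv, inv_inv, norm_mul, norm_mul, norm_inv, htn]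
        have : t⁻¹ * ‖q‖ ≤ 1 := by rw [inv_mul_le_iff₀ ht0]; linarith [ht.1]
        nlinarith
      have hx0 : (t : ℂ) * q⁻¹ ≠ 0 := mul_ne_zero htc (inv_ne_zero hq0)
      -- The zero of ϑ(q⁻⁴x) at x = 1/q cancels the pole: at x = t/q it contributes (t; q¹⁰)_∞ = (1
      -- - t)(tq¹⁰; q¹⁰)_∞.
      rw [← hc _ hx0 hx1 hx2, thetaSum_eq_qPoch hp0 hp
        (mul_ne_zero (inv_ne_zero (pow_ne_zero 4 hq0)) hx0),
        show q ^ 5 * ((q ^ 4)⁻¹ * (t * q⁻¹)) = t by field_simp,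
        show q ^ 5 * ((q ^ 4)⁻¹ * (t * q⁻¹))⁻¹ = q ^ 10 * (t : ℂ)⁻¹ by field_simp,
        ← pow_mul, qPoch_eq_mul (t : ℂ) hQ]
      ring
  have h := hc x hx hx1 hx2
  have hD := thetaSum_product hq0 hq hx
  rw [hc'] at h
  apply mul_left_cancel₀ (pow_ne_zero 4 hQ0)
  linear_combination (thetaSum (q ^ 5) x * qPoch (q ^ 2) (q ^ 2)) * h -
    (∑' n, lambertCoeff q n * x ^ n) * hD

end ClosedForm

/-! ### The induced character modulo 10. -/

section Character

lemma isCoprime_ten_iff (n : ℤ) :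
    IsCoprime n ((10 : ℕ) : ℤ) ↔ n % 10 = 1 ∨ n % 10 = 3 ∨ n % 10 = 7 ∨ n % 10 = 9 := by
  rw [Int.isCoprime_iff_gcd_eq_one, ← Int.gcd_emod]
  have h0 := Int.emod_nonneg n (by norm_num : (10 : ℤ) ≠ 0)
  have h1 := Int.emod_lt_of_pos n (by norm_num : (0 : ℤ) < 10)
  push_cast
  generalize n % 10 = r at *
  interval_cases r <;> decide

lemma psi10_eq_chi5 {n : ℤ} (hn : IsCoprime n ((10 : ℕ) : ℤ)) :
    psi10 (n : ZMod 10) = chi5 (n : ZMod 5) :=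
  DirichletCharacter.changeLevel_eq_cast_of_dvd' _ _ hn

lemma chi5_eq_one {a : ZMod 5} (ha : a ≠ 0) (h : IsSquare a) : chi5 a = 1 := by
  have : Fact (Nat.Prime 5) := ⟨Nat.prime_five⟩
  have := (quadraticChar_one_iff_isSquare ha).2 h
  simp [chi5, this]

lemma chi5_eq_neg_one {a : ZMod 5} (h : ¬ IsSquare a) : chi5 a = -1 := by
  have : Fact (Nat.Prime 5) := ⟨Nat.prime_five⟩
  have := (quadraticChar_neg_one_iff_not_isSquare).2 h
  simp [chi5, this]

lemma intCast_zmod_five (n : ℤ) : (n : ZMod 5) = ((n % 10 : ℤ) : ZMod 5) := by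
  rw [ZMod.intCast_eq_intCast_iff_dvd_sub]
  push_cast
  lia

lemma psi10_intCast (n : ℤ) : psi10 (n : ZMod 10) =
    if n % 10 = 1 ∨ n % 10 = 9 then 1 else if n % 10 = 3 ∨ n % 10 = 7 then -1 else 0 := by
  by_cases hn : IsCoprime n ((10 : ℕ) : ℤ)
  · rw [psi10_eq_chi5 hn, intCast_zmod_five]
    rcases (isCoprime_ten_iff n).1 hn with h | h | h | h <;> rw [h]
    · simp
    · simpa using chi5_eq_neg_one (a := 3) (by decide)
    · simpa using chi5_eq_neg_one (a := 7) (by decide)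
    · simpa using chi5_eq_one (a := 9) (by decide) (by decide)
  · rw [(DirichletCharacter.apply_eq_zero_iff psi10 n).2 hn]
    rw [isCoprime_ten_iff] at hn
    rw [if_neg (by lia), if_neg (by lia)]

/-- Being induced from level 5, the character has conductor dividing 5, so not 10. -/
lemma not_isPrimitive_psi10 : ¬ psi10.IsPrimitive := by
  intro h
  rw [DirichletCharacter.isPrimitive_def] at h
  have h5 : psi10.conductor ∣ 5 := psi10.conductor_dvd_of_mem_conductorSet
    (DirichletCharacter.changeLevel_factorsThrough chi5 (by norm_num : 5 ∣ 10))
  rw [h] at h5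
  norm_num at h5

lemma psi10_natCast (n : ℕ) : psi10 (n : ZMod 10) =
    if n % 10 = 1 ∨ n % 10 = 9 then 1 else if n % 10 = 3 ∨ n % 10 = 7 then -1 else 0 := by
  have h := psi10_intCast n
  rw [Int.cast_natCast] at h
  rw [h]
  congr 1
  · simp only [eq_iff_iff]; lia
  · congr 1
    simp only [eq_iff_iff]; lia

/-- The generating function of `psi10`. -/
lemma hasSum_psi10_mul_pow {y : ℂ} (hy : ‖y‖ < 1) :
    HasSum (fun n : ℕ => psi10 (n : ZMod 10) * y ^ n)
      ((y - y ^ 3 - y ^ 7 + y ^ 9) / (1 - y ^ 10)) := by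
  have hs : Summable fun n : ℕ => psi10 (n : ZMod 10) * y ^ n := by
    refine Summable.of_norm_bounded (summable_geometric_of_lt_one (norm_nonneg y) hy) fun n => ?_
    rw [norm_mul, norm_pow]
    exact mul_le_of_le_one_left (by positivity) (DirichletCharacter.norm_le_one _ _)
  -- Periodicity modulo 10 gives S = (first ten terms) + y¹⁰ S.
  have h1 := hs.sum_add_tsum_nat_add 10
  have h2 : ∑' n : ℕ, psi10 ((n + 10 : ℕ) : ZMod 10) * y ^ (n + 10) =
      y ^ 10 * ∑' n : ℕ, psi10 (n : ZMod 10) * y ^ n := by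
    rw [← tsum_mul_left]
    refine tsum_congr fun n => ?_
    rw [psi10_natCast, psi10_natCast, Nat.add_mod_right]
    ring
  rw [h2] at h1
  have h3 := hs.hasSum
  generalize ∑' n : ℕ, psi10 (n : ZMod 10) * y ^ n = S at h1 h3
  simp only [psi10_natCast, Finset.sum_range_succ, Finset.sum_range_zero] at h1
  norm_num at h1
  have hne : 1 - y ^ 10 ≠ 0 := by
    rw [sub_ne_zero]
    intro h
    have := norm_pow_lt_one hy (m := 10) (by norm_num)
    rw [← h] at this
    simp at this
  convert h3 using 1
  rw [div_eq_iff hne]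
  linear_combination h1

end Character

/-! ### θ₁, θ₄ and η in terms of `thetaSum` and `qPoch`. -/

section ThetaFunctions

lemma theta4_eq_thetaSum {τ : ℂ} (hτ : 0 < τ.im) (z : ℂ) :
    theta4 z τ = thetaSum (cexp (Real.pi * I * τ)) (cexp (2 * I * z)) := by
  have hp : ‖cexp (Real.pi * I * τ)‖ < 1 := by
    rw [norm_exp, Real.exp_lt_one_iff]
    simpa using mul_pos Real.pi_pos hτ
  have hs := (summable_norm_thetaSum (exp_ne_zero _) hp (exp_ne_zero (2 * I * z))).of_norm
  rw [theta4, thetaSum, tsum_int_eq_zero_add_tsum_pnat hs]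
  have h1 := hs.comp_injective (Nat.cast_injective.comp PNat.coe_injective : Function.Injective
    fun n : ℕ+ => ((n : ℕ) : ℤ))
  have h2 := hs.comp_injective (neg_injective.comp (Nat.cast_injective.comp PNat.coe_injective) :
    Function.Injective fun n : ℕ+ => -((n : ℕ) : ℤ))
  simp only [Function.comp_def] at h1 h2
  rw [add_assoc, ← h1.tsum_add h2, ← tsum_mul_left]
  congr 1
  · simp
  · refine tsum_congr fun n => ?_
    have e := two_cos (2 * (n : ℂ) * z)
    rw [show 2 * (n : ℂ) * z * I = (n : ℕ) * (2 * I * z) by ring,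
      show -(2 * (n : ℂ) * z) * I = -((n : ℕ) * (2 * I * z)) by ring, exp_neg, exp_nat_mul] at e
    rw [neg_sq, zpow_neg, zpow_neg, ← inv_zpow, show (-1 : ℂ)⁻¹ = -1 by norm_num, zpow_natCast,
      zpow_natCast, ← Nat.cast_pow, zpow_natCast]
    linear_combination ((-1) ^ (n : ℕ) * cexp (Real.pi * I * τ) ^ ((n : ℕ) ^ 2)) * e

/-- Pair the indices n and -(n + 1): they share the power p^{n(n+1)} and have opposite signs,
producing the sines of θ₁. -/
lemma hasSum_odd_theta {p y : ℂ} (hp0 : p ≠ 0) (hp : ‖p‖ < 1) (hy : y ≠ 0) :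
    HasSum (fun n : ℕ => (-1) ^ n * p ^ (n * (n + 1)) * (y ^ (2 * n + 1) - (y ^ (2 * n + 1))⁻¹))
      (y * thetaSum p (p * y ^ 2)) := by
  have hx : p * y ^ 2 ≠ 0 := mul_ne_zero hp0 (pow_ne_zero _ hy)
  have hs := (summable_norm_thetaSum hp0 hp hx).of_norm.mul_left y
  have h1 := hs.hasSum.nat_add_neg_add_one
  rw [tsum_mul_left] at h1
  refine h1.congr_fun fun n => ?_
  have e1 : y * ((-1) ^ (n : ℤ) * p ^ ((n : ℤ) ^ 2) * (p * y ^ 2) ^ (n : ℤ)) =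
      (-1) ^ n * p ^ (n * (n + 1)) * y ^ (2 * n + 1) := by
    norm_cast
    ring
  have e2 : y * ((-1) ^ (-((n : ℤ) + 1)) * p ^ ((-((n : ℤ) + 1)) ^ 2) *
      (p * y ^ 2) ^ (-((n : ℤ) + 1))) =
      -((-1) ^ n * p ^ (n * (n + 1)) * (y ^ (2 * n + 1))⁻¹) := by
    rw [neg_sq, zpow_neg, zpow_neg, ← inv_zpow, show (-1 : ℂ)⁻¹ = -1 by norm_num,
      ← Nat.cast_succ, ← Nat.cast_pow, zpow_natCast, zpow_natCast, zpow_natCast, Nat.succ_eq_add_one]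
    rw [show (n + 1) ^ 2 = n * (n + 1) + (n + 1) by ring, pow_add p, mul_pow, ← pow_mul,
      show 2 * (n + 1) = 2 * n + 1 + 1 by ring, pow_succ y (2 * n + 1), pow_succ (-1 : ℂ) n]
    have h3 := pow_ne_zero (n + 1) hp0
    have h4 := pow_ne_zero (2 * n + 1) hy
    field_simp
  rw [e1, e2]
  ring

lemma theta1_eq_thetaSum {τ : ℂ} (hτ : 0 < τ.im) (z : ℂ) :
    theta1 z τ = -I * cexp (2 * Real.pi * I * τ / 8) * (cexp (I * z) *
      thetaSum (cexp (Real.pi * I * τ)) (cexp (Real.pi * I * τ) * cexp (I * z) ^ 2)) := by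
  have hp : ‖cexp (Real.pi * I * τ)‖ < 1 := by
    rw [norm_exp, Real.exp_lt_one_iff]
    simpa using mul_pos Real.pi_pos hτ
  rw [← (hasSum_odd_theta (exp_ne_zero _) hp (exp_ne_zero (I * z))).tsum_eq, theta1,
    ← tsum_mul_left, ← tsum_mul_left]
  refine tsum_congr fun n => ?_
  have e1 : nome τ ^ (n * (n + 1) / 2) = cexp (Real.pi * I * τ) ^ (n * (n + 1)) := by
    rw [nome, show 2 * (Real.pi : ℂ) * I * τ = (2 : ℕ) * (Real.pi * I * τ) by push_cast; ring,
      exp_nat_mul, ← pow_mul, Nat.mul_div_cancel' (Nat.even_mul_succ_self n).two_dvd]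
  have e2 := two_sin ((2 * (n : ℂ) + 1) * z)
  rw [show (2 * (n : ℂ) + 1) * z * I = (2 * n + 1 : ℕ) * (I * z) by push_cast; ring,
    show -((2 * (n : ℂ) + 1) * z) * I = -((2 * n + 1 : ℕ) * (I * z)) by push_cast; ring,
    exp_neg, exp_nat_mul] at e2
  rw [e1]
  generalize cexp (I * z) ^ (2 * n + 1) = Y at *
  generalize cexp (Real.pi * I * τ) ^ (n * (n + 1)) = A at *
  linear_combination (cexp (2 * Real.pi * I * τ / 8) * (-1) ^ n * A) * e2

lemma eta_eq_qPoch (τ : ℂ) :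
    ModularForm.eta τ = cexp (2 * Real.pi * I * τ / 24) * qPoch (nome τ) (nome τ) := by
  rw [ModularForm.eta, qPoch]
  congr 1
  refine tprod_congr fun n => ?_
  rw [ModularForm.eta_q_eq_pow, nome, pow_succ']

end ThetaFunctions

lemma hasSum_of_eq {ι : Type*} {f g : ι → ℂ} {s t : ℂ} (h : HasSum f s) (hf : ∀ n, g n = f n)
    (hs : t = s) : HasSum g t := by
  rwa [funext hf, hs]

/-! ### The sine series in closed form. -/

section SineSeries

variable {q z : ℂ}

lemma hasSum_pnat_of_hasSum_nat {f : ℕ → ℂ} {s : ℂ} (h0 : f 0 = 0) (h : HasSum f s) :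
    HasSum (fun n : ℕ+ => f n) s := by
  refine (PNat.coe_injective.hasSum_iff fun n hn => ?_).2 h
  rcases Nat.eq_zero_or_pos n with rfl | hn'
  · exact h0
  · exact absurd ⟨⟨n, hn'⟩, rfl⟩ hn

lemma hasSum_lambert10_mul_sin (hq0 : q ≠ 0) (hq : ‖q‖ < 1) (hx1 : ‖q * cexp (2 * I * z)‖ < 1)
    (hx2 : ‖q * (cexp (2 * I * z))⁻¹‖ < 1) :
    HasSum (fun n : ℕ+ => lambert10 q n * Complex.sin (2 * (n : ℂ) * z))
      (q * qPoch (q ^ 2) (q ^ 2) ^ 2 *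
        (-I * (cexp (2 * I * z) * thetaSum (q ^ 5) (q ^ 5 * cexp (2 * I * z) ^ 2))) *
        thetaSum (q ^ 5) (cexp (2 * I * z)) /
        (2 * qPoch (q ^ 10) (q ^ 10) * thetaSum q (cexp (2 * I * z)))) := by
  have hx0 := exp_ne_zero (2 * I * z)
  have hQ : ‖q ^ 10‖ < 1 := norm_pow_lt_one hq (by norm_num)
  have hE := qPoch_ne_zero_of_norm_lt hQ hQ
  have hT := thetaSum_ne_zero hq0 hq hx0 hx1 hx2
  have h := (hasSum_lambertCoeff hq0 hq hx1 hx2).mul_left (-I / 2)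
  have hF := tsum_lambertCoeff_mul hq0 hq hx0 hx1 hx2
  rw [← eq_div_iff (mul_ne_zero hE hT)] at hF
  rw [hF] at h
  have h' : HasSum (fun n : ℕ => lambert10 q n * Complex.sin (2 * (n : ℂ) * z))
      (q * qPoch (q ^ 2) (q ^ 2) ^ 2 *
        (-I * (cexp (2 * I * z) * thetaSum (q ^ 5) (q ^ 5 * cexp (2 * I * z) ^ 2))) *
        thetaSum (q ^ 5) (cexp (2 * I * z)) /
        (2 * qPoch (q ^ 10) (q ^ 10) * thetaSum q (cexp (2 * I * z)))) := by
    refine hasSum_of_eq h (fun n => ?_) ?_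
    · have e := two_sin (2 * (n : ℂ) * z)
      rw [show 2 * (n : ℂ) * z * I = n * (2 * I * z) by ring,
        show -(2 * (n : ℂ) * z) * I = -(n * (2 * I * z)) by ring, exp_neg, exp_nat_mul] at e
      rw [inv_pow]
      linear_combination (lambert10 q n / 2) * e
    · field_simp
  exact hasSum_pnat_of_hasSum_nat (by simp [lambert10_zero]) h'

/-- The sine series with the factor `sin 2z` extracted. -/
lemma hasSum_lambert10_mul_sin_eq_qPoch (hq0 : q ≠ 0) (hq : ‖q‖ < 1)
    (hx1 : ‖q * cexp (2 * I * z)‖ < 1) (hx2 : ‖q * (cexp (2 * I * z))⁻¹‖ < 1) :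
    HasSum (fun n : ℕ+ => lambert10 q n * Complex.sin (2 * (n : ℂ) * z))
      (q * qPoch (q ^ 2) (q ^ 2) ^ 2 * Complex.sin (2 * z) *
        (qPoch (q ^ 10 * cexp (2 * I * z) ^ 2) (q ^ 10) *
          qPoch (q ^ 10 * (cexp (2 * I * z) ^ 2)⁻¹) (q ^ 10)) *
        thetaSum (q ^ 5) (cexp (2 * I * z)) / thetaSum q (cexp (2 * I * z))) := by
  have hx0 := exp_ne_zero (2 * I * z)
  have hp0 : q ^ 5 ≠ 0 := pow_ne_zero 5 hq0
  have hp : ‖q ^ 5‖ < 1 := norm_pow_lt_one hq (by norm_num)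
  have hQ : ‖q ^ 10‖ < 1 := norm_pow_lt_one hq (by norm_num)
  have hE := qPoch_ne_zero_of_norm_lt hQ hQ
  convert hasSum_lambert10_mul_sin hq0 hq hx1 hx2 using 1
  have e := two_sin (2 * z)
  rw [show 2 * z * I = 2 * I * z by ring, show -(2 * z) * I = -(2 * I * z) by ring, exp_neg] at e
  generalize cexp (2 * I * z) = x at *
  -- The first factor 1 - x⁻² of the triple product, times the prefactor x, is x - x⁻¹ = 2i sin 2z.
  rw [thetaSum_eq_qPoch (x := q ^ 5 * x ^ 2) hp0 hp (mul_ne_zero hp0 (pow_ne_zero 2 hx0)),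
    ← pow_mul, show q ^ 5 * (q ^ 5 * x ^ 2) = q ^ 10 * x ^ 2 by ring,
    show q ^ 5 * (q ^ 5 * x ^ 2)⁻¹ = (x ^ 2)⁻¹ by field_simp, qPoch_eq_mul (x ^ 2)⁻¹ hQ,
    mul_comm (x ^ 2)⁻¹ (q ^ 10), show Complex.sin (2 * z) = (x⁻¹ - x) * I / 2 by
      linear_combination e / 2]
  norm_num
  field_simp
  ring

lemma hasSum_lambert10_mul_sin_real (hq0 : q ≠ 0) (hq : ‖q‖ < 1) (t : ℝ) :
    HasSum (fun n : ℕ+ => lambert10 q n * Complex.sin (2 * (n : ℂ) * t))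
      (q * qPoch (q ^ 2) (q ^ 2) ^ 2 * Complex.sin (2 * t) *
        (qPoch (q ^ 10 * cexp (2 * I * t) ^ 2) (q ^ 10) *
          qPoch (q ^ 10 * (cexp (2 * I * t) ^ 2)⁻¹) (q ^ 10)) *
        thetaSum (q ^ 5) (cexp (2 * I * t)) / thetaSum q (cexp (2 * I * t))) := by
  have hn : ‖cexp (2 * I * t)‖ = 1 := by simp [norm_exp]
  exact hasSum_lambert10_mul_sin_eq_qPoch hq0 hq (by rwa [norm_mul, hn, mul_one])
    (by rwa [norm_mul, norm_inv, hn, inv_one, mul_one])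

end SineSeries

/-! ### The evaluations at z = π/3 and z = π/4. -/

section SpecialValues

variable {a q : ℂ}

lemma thetaSum_one (ha0 : a ≠ 0) (ha : ‖a‖ < 1) :
    thetaSum a 1 = qPoch a a ^ 2 / qPoch (a ^ 2) (a ^ 2) := by
  have h2 := norm_pow_lt_one ha two_ne_zero
  have hE := qPoch_ne_zero_of_norm_lt h2 h2
  rw [thetaSum_eq_qPoch ha0 ha one_ne_zero, inv_one, mul_one, ← qPoch_self_sq ha]
  field_simp

lemma thetaSum_I (ha0 : a ≠ 0) (ha : ‖a‖ < 1) :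
    thetaSum a I = qPoch (a ^ 4) (a ^ 4) ^ 2 / qPoch (a ^ 8) (a ^ 8) := by
  have h2 := norm_pow_lt_one ha two_ne_zero
  have h4 : ‖a ^ 4‖ < 1 := norm_pow_lt_one ha (by norm_num)
  have h8 : ‖a ^ 8‖ < 1 := norm_pow_lt_one ha (by norm_num)
  have hE8 := qPoch_ne_zero_of_norm_lt h8 h8
  have hE := qPoch_ne_zero_of_norm_lt (a := a ^ 2) h4 h2
  have e1 := qPoch_mul_neg (a * I) h2
  have e2 := qPoch_mul_neg (a ^ 2) h4
  have e3 := qPoch_self_sq h2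
  have e4 := qPoch_self_sq h4
  rw [mul_pow, I_sq, mul_neg_one] at e1
  simp only [← pow_mul, Nat.reduceMul] at e1 e2 e3 e4
  rw [thetaSum_eq_qPoch ha0 ha I_ne_zero, inv_I, mul_neg, mul_assoc, e1, eq_div_iff hE8]
  apply mul_left_cancel₀ hE
  linear_combination (qPoch (a ^ 2) (a ^ 2) * qPoch (a ^ 8) (a ^ 8)) * e2 +
    qPoch (a ^ 2) (a ^ 2) * e4 - qPoch (a ^ 4) (a ^ 4) * e3

lemma thetaSum_cube_root {w : ℂ} (ha0 : a ≠ 0) (ha : ‖a‖ < 1) (hw : w ^ 2 + w + 1 = 0) :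
    thetaSum a w = qPoch (a ^ 2) (a ^ 2) ^ 2 * qPoch (a ^ 3) (a ^ 3) /
      (qPoch a a * qPoch (a ^ 6) (a ^ 6)) := by
  have h2 := norm_pow_lt_one ha two_ne_zero
  have h3 : ‖a ^ 3‖ < 1 := norm_pow_lt_one ha (by norm_num)
  have h6 : ‖a ^ 6‖ < 1 := norm_pow_lt_one ha (by norm_num)
  have hE1 := qPoch_ne_zero_of_norm_lt ha ha
  have hE6 := qPoch_ne_zero_of_norm_lt h6 h6
  have hw0 : w ≠ 0 := by rintro rfl; norm_num at hw
  have hw2 : w⁻¹ = w ^ 2 := by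
    refine inv_eq_of_mul_eq_one_right ?_
    linear_combination (w - 1) * hw
  have e1 := qPoch_mul_cube_roots a h2 hw
  have e2 := qPoch_self_sq ha
  have e3 := qPoch_self_sq h3
  simp only [← pow_mul, Nat.reduceMul] at e1 e3
  rw [thetaSum_eq_qPoch ha0 ha hw0, hw2, mul_assoc, eq_div_iff (mul_ne_zero hE1 hE6), ← e2, ← e3,
    ← e1]
  ring

lemma qPoch_neg_self (ha : ‖a‖ < 1) : qPoch (-a) a = qPoch (a ^ 2) (a ^ 2) / qPoch a a := by
  rw [eq_div_iff (qPoch_ne_zero_of_norm_lt ha ha), mul_comm, qPoch_mul_neg a ha]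

lemma sin_two_pi_div_three_ne_zero : Complex.sin (2 * (Real.pi / 3 : ℝ)) ≠ 0 := by
  have h : 0 < Real.sin (2 * (Real.pi / 3)) :=
    Real.sin_pos_of_pos_of_lt_pi (by positivity) (by linarith [Real.pi_pos])
  have := h.ne'
  exact_mod_cast this

/-- Both sides depend only on n modulo 3, and sin(4π/3) = -sin(2π/3). -/
lemma sin_mul_pi_div_three (n : ℕ) :
    Complex.sin (2 * (n : ℂ) * (Real.pi / 3 : ℝ)) =
      ((legendreSym 3 (n : ℕ) : ℤ) : ℂ) * Complex.sin (2 * (Real.pi / 3 : ℝ)) := by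
  rw [legendreSym.mod]
  obtain ⟨k, hk⟩ : ∃ k, n = 3 * k + n % 3 := ⟨n / 3, by lia⟩
  have h : n % 3 = 0 ∨ n % 3 = 1 ∨ n % 3 = 2 := by lia
  rcases h with h | h | h <;> rw [h] at hk <;> subst hk
  · rw [show ((3 * k + 0 : ℕ) : ℤ) % ((3 : ℕ) : ℤ) = 0 by push_cast; lia]
    rw [show (2 : ℂ) * ((3 * k + 0 : ℕ) : ℂ) * ((Real.pi / 3 : ℝ) : ℂ) = 0 + k * (2 * Real.pi) by
      push_cast; ring, sin_add_nat_mul_two_pi]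
    simp
  · rw [show ((3 * k + 1 : ℕ) : ℤ) % ((3 : ℕ) : ℤ) = 1 by push_cast; lia]
    rw [show (2 : ℂ) * ((3 * k + 1 : ℕ) : ℂ) * ((Real.pi / 3 : ℝ) : ℂ) =
      2 * (Real.pi / 3 : ℝ) + k * (2 * Real.pi) by push_cast; ring, sin_add_nat_mul_two_pi]
    simp
  · rw [show ((3 * k + 2 : ℕ) : ℤ) % ((3 : ℕ) : ℤ) = 2 by push_cast; lia]
    rw [show (2 : ℂ) * ((3 * k + 2 : ℕ) : ℂ) * ((Real.pi / 3 : ℝ) : ℂ) =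
      2 * Real.pi - 2 * (Real.pi / 3 : ℝ) + k * (2 * Real.pi) by push_cast; ring,
      sin_add_nat_mul_two_pi, sin_two_pi_sub, show legendreSym 3 2 = -1 by decide]
    push_cast
    ring

lemma sin_mul_pi_div_four (n : ℕ) :
    Complex.sin (2 * (n : ℂ) * (Real.pi / 4 : ℝ)) =
      ((ZMod.χ₄ ((n : ℕ) : ZMod 4) : ℤ) : ℂ) := by
  rw [ZMod.χ₄_nat_mod_four]
  obtain ⟨k, hk⟩ : ∃ k, n = 4 * k + n % 4 := ⟨n / 4, by lia⟩
  have h : n % 4 = 0 ∨ n % 4 = 1 ∨ n % 4 = 2 ∨ n % 4 = 3 := by lia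
  have e : ∀ r : ℕ, Complex.sin (2 * ((4 * k + r : ℕ) : ℂ) * (Real.pi / 4 : ℝ)) =
      Complex.sin (r * (Real.pi / 2)) := fun r => by
    rw [show (2 : ℂ) * ((4 * k + r : ℕ) : ℂ) * ((Real.pi / 4 : ℝ) : ℂ) =
      r * (Real.pi / 2) + k * (2 * Real.pi) by push_cast; ring, sin_add_nat_mul_two_pi]
  rcases h with h | h | h | h <;> rw [h] at hk ⊢ <;> rw [hk, e]
  · rw [show ZMod.χ₄ ((0 : ℕ) : ZMod 4) = 0 by decide]; simp
  · rw [show ZMod.χ₄ ((1 : ℕ) : ZMod 4) = 1 by decide]; simp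
  · rw [show ZMod.χ₄ ((2 : ℕ) : ZMod 4) = 0 by decide]
    simp [mul_div_cancel₀]
  · rw [show ZMod.χ₄ ((3 : ℕ) : ZMod 4) = -1 by decide,
      show (((3 : ℕ) : ℂ)) * (Real.pi / 2) = Real.pi / 2 + Real.pi by push_cast; ring, sin_add_pi]
    simp

theorem hasSum_legendreSym_mul_lambert10 (hq0 : q ≠ 0) (hq : ‖q‖ < 1) :
    HasSum (fun n : ℕ+ => ((legendreSym 3 (n : ℕ) : ℤ) : ℂ) * lambert10 q n)
      (q * qPoch q q * qPoch (q ^ 6) (q ^ 6) * qPoch (q ^ 10) (q ^ 10) * qPoch (q ^ 15) (q ^ 15) /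
        (qPoch (q ^ 3) (q ^ 3) * qPoch (q ^ 5) (q ^ 5))) := by
  have h := hasSum_lambert10_mul_sin_real hq0 hq (Real.pi / 3)
  have hs := sin_two_pi_div_three_ne_zero
  set w := cexp (2 * I * (Real.pi / 3 : ℝ)) with hwdef
  have hprim : IsPrimitiveRoot w 3 := by
    have := Complex.isPrimitiveRoot_exp 3 (by norm_num)
    rwa [show 2 * (Real.pi : ℂ) * I / (3 : ℕ) = 2 * I * (Real.pi / 3 : ℝ) by push_cast; ring]
      at this
  have hw : w ^ 2 + w + 1 = 0 := by
    have := hprim.geom_sum_eq_zero (by norm_num)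
    simp only [Finset.sum_range_succ, Finset.sum_range_zero] at this
    linear_combination this
  have hw2 : (w ^ 2)⁻¹ = w := by
    refine inv_eq_of_mul_eq_one_right ?_
    linear_combination (w - 1) * hw
  have hne : ∀ m : ℕ, m ≠ 0 → qPoch (q ^ m) (q ^ m) ≠ 0 := fun m hm =>
    qPoch_ne_zero_of_norm_lt (norm_pow_lt_one hq hm) (norm_pow_lt_one hq hm)
  have e1 := qPoch_mul_cube_roots (q ^ 10) (norm_pow_lt_one hq (m := 10) (by norm_num)) hw
  have e1' : qPoch (q ^ 10 * w ^ 2) (q ^ 10) * qPoch (q ^ 10 * w) (q ^ 10) =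
      qPoch (q ^ 30) (q ^ 30) / qPoch (q ^ 10) (q ^ 10) := by
    rw [eq_div_iff (hne 10 (by norm_num)), show q ^ 30 = (q ^ 10) ^ 3 by ring, ← e1]
    ring
  rw [hw2, e1', thetaSum_cube_root hq0 hq hw,
    thetaSum_cube_root (pow_ne_zero 5 hq0) (norm_pow_lt_one hq (by norm_num)) hw] at h
  simp only [← pow_mul, Nat.reduceMul] at h
  have h1 := qPoch_ne_zero_of_norm_lt hq hq
  have h2 := hne 2 (by norm_num)
  have h3 := hne 3 (by norm_num)
  have h5 := hne 5 (by norm_num)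
  have h6 := hne 6 (by norm_num)
  have h10 := hne 10 (by norm_num)
  have h30 := hne 30 (by norm_num)
  refine hasSum_of_eq (h.div_const (Complex.sin (2 * (Real.pi / 3 : ℝ)))) (fun n => ?_) ?_
  · rw [sin_mul_pi_div_three, ← mul_assoc, mul_div_cancel_right₀ _ hs, mul_comm]
  · field_simp

theorem hasSum_chi_four_mul_lambert10 (hq0 : q ≠ 0) (hq : ‖q‖ < 1) :
    HasSum (fun n : ℕ+ => ((ZMod.χ₄ ((n : ℕ) : ZMod 4) : ℤ) : ℂ) * lambert10 q n)
      (q * qPoch (q ^ 2) (q ^ 2) ^ 2 * qPoch (q ^ 8) (q ^ 8) * qPoch (q ^ 20) (q ^ 20) ^ 4 /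
        (qPoch (q ^ 4) (q ^ 4) ^ 2 * qPoch (q ^ 10) (q ^ 10) ^ 2 * qPoch (q ^ 40) (q ^ 40))) := by
  have h := hasSum_lambert10_mul_sin_real hq0 hq (Real.pi / 4)
  have hI : cexp (2 * I * (Real.pi / 4 : ℝ)) = I := by
    rw [show 2 * I * ((Real.pi / 4 : ℝ) : ℂ) = Real.pi / 2 * I by push_cast; ring,
      exp_pi_div_two_mul_I]
  have hsin : Complex.sin (2 * (Real.pi / 4 : ℝ)) = 1 := by
    rw [show (2 : ℂ) * ((Real.pi / 4 : ℝ) : ℂ) = Real.pi / 2 by push_cast; ring, sin_pi_div_two]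
  have hne : ∀ m : ℕ, m ≠ 0 → qPoch (q ^ m) (q ^ m) ≠ 0 := fun m hm =>
    qPoch_ne_zero_of_norm_lt (norm_pow_lt_one hq hm) (norm_pow_lt_one hq hm)
  rw [hI, hsin, I_sq, inv_neg, inv_one, mul_neg_one,
    qPoch_neg_self (norm_pow_lt_one hq (by norm_num)), thetaSum_I hq0 hq,
    thetaSum_I (pow_ne_zero 5 hq0) (norm_pow_lt_one hq (by norm_num))] at h
  simp only [← pow_mul, Nat.reduceMul] at h
  have h4 := hne 4 (by norm_num)
  have h8 := hne 8 (by norm_num)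
  have h10 := hne 10 (by norm_num)
  have h40 := hne 40 (by norm_num)
  refine hasSum_of_eq h (fun n => ?_) ?_
  · rw [sin_mul_pi_div_four, mul_comm]
  · field_simp

end SpecialValues

/-! ### The limit z → 0 and the series over ψ. -/

section Derivative

variable {q : ℂ}

lemma summable_mul_norm_lambert10 (hq : ‖q‖ < 1) :
    Summable fun n : ℕ+ => 2 * (n : ℝ) * ‖lambert10 q n‖ := by
  have h0 := summable_pow_mul_geometric_of_norm_lt_one 1
    (show ‖(‖q‖ : ℝ)‖ < 1 by rwa [norm_norm])
  have h1 : Summable fun n : ℕ => 2 * (4 / (1 - ‖q‖)) * ((n : ℝ) ^ 1 * ‖q‖ ^ n) := h0.mul_left _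
  refine Summable.of_nonneg_of_le (fun n => by positivity) (fun n => ?_)
    (h1.comp_injective PNat.coe_injective)
  have := norm_lambert10_le hq n.ne_zero
  have hn : (0 : ℝ) ≤ 2 * (n : ℕ) := by positivity
  calc _ ≤ 2 * ((n : ℕ) : ℝ) * (4 / (1 - ‖q‖) * ‖q‖ ^ (n : ℕ)) := by gcongr
    _ = _ := by simp only [Function.comp_apply]; ring

lemma tendsto_sin_mul_div (c : ℝ) :
    Tendsto (fun t : ℝ => Complex.sin (c * t) / t) (𝓝[≠] 0) (𝓝 (c : ℂ)) := by
  have h : HasDerivAt (fun t : ℝ => Complex.sin (c * t)) (c : ℂ) 0 := by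
    have h1 : HasDerivAt (fun t : ℂ => Complex.sin (c * t)) (Complex.cos (c * (0 : ℝ)) * (c * 1))
        (0 : ℝ) :=
      (Complex.hasDerivAt_sin _).comp _ ((hasDerivAt_id _).const_mul (c : ℂ))
    have h2 := h1.comp_ofReal
    simpa using h2
  have h2 := hasDerivAt_iff_tendsto_slope_zero.1 h
  refine h2.congr fun t => ?_
  simp [div_eq_inv_mul]

theorem hasSum_nat_mul_lambert10 (hq0 : q ≠ 0) (hq : ‖q‖ < 1) :
    HasSum (fun n : ℕ+ => (n : ℂ) * lambert10 q n)
      (q * qPoch (q ^ 2) (q ^ 2) ^ 3 * qPoch (q ^ 5) (q ^ 5) ^ 2 * qPoch (q ^ 10) (q ^ 10) /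
        qPoch q q ^ 2) := by
  have hb := summable_mul_norm_lambert10 hq
  have hp0 : q ^ 5 ≠ 0 := pow_ne_zero 5 hq0
  have hp : ‖q ^ 5‖ < 1 := norm_pow_lt_one hq (by norm_num)
  have hQ : ‖q ^ 10‖ < 1 := norm_pow_lt_one hq (by norm_num)
  -- Termwise limit of the series divided by t, dominated through |sin 2nt| ≤ 2n|t|.
  have hL : Tendsto (fun t : ℝ => ∑' n : ℕ+, lambert10 q n * (Complex.sin ((2 * n : ℝ) * t) / t))
      (𝓝[≠] 0) (𝓝 (∑' n : ℕ+, lambert10 q n * (2 * n : ℝ))) := by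
    refine tendsto_tsum_of_dominated_convergence hb
      (fun n => (tendsto_sin_mul_div _).const_mul _) ?_
    filter_upwards [self_mem_nhdsWithin] with t ht n
    have ht0 : 0 < |t| := abs_pos.2 ht
    rw [norm_mul, mul_comm, norm_div, norm_real, Real.norm_eq_abs]
    gcongr
    rw [div_le_iff₀ ht0, ← ofReal_mul, ← ofReal_sin, norm_real, Real.norm_eq_abs]
    refine Real.abs_sin_le_abs.trans ?_
    rw [abs_mul, abs_of_nonneg (by positivity)]
  have hx : Tendsto (fun t : ℝ => cexp (2 * I * t)) (𝓝[≠] 0) (𝓝 1) := by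
    have : Tendsto (fun t : ℝ => cexp (2 * I * t)) (𝓝 0) (𝓝 (cexp (2 * I * (0 : ℝ)))) :=
      Continuous.tendsto (by fun_prop) 0
    rw [ofReal_zero, mul_zero, exp_zero] at this
    exact this.mono_left nhdsWithin_le_nhds
  have hcp := continuous_qPoch hQ
  have hA : Tendsto (fun t : ℝ => qPoch (q ^ 10 * cexp (2 * I * t) ^ 2) (q ^ 10)) (𝓝[≠] 0)
      (𝓝 (qPoch (q ^ 10) (q ^ 10))) := by
    have := (hcp.tendsto _).comp ((hx.pow 2).const_mul (q ^ 10))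
    rwa [one_pow, mul_one] at this
  have hB : Tendsto (fun t : ℝ => qPoch (q ^ 10 * (cexp (2 * I * t) ^ 2)⁻¹) (q ^ 10)) (𝓝[≠] 0)
      (𝓝 (qPoch (q ^ 10) (q ^ 10))) := by
    have := (hcp.tendsto _).comp (((hx.pow 2).inv₀ (by simp)).const_mul (q ^ 10))
    rwa [one_pow, inv_one, mul_one] at this
  have hT1 := (continuousAt_thetaSum hp0 hp one_ne_zero).tendsto.comp hx
  have hT2 := (continuousAt_thetaSum hq0 hq one_ne_zero).tendsto.comp hx
  have hne : thetaSum q 1 ≠ 0 := thetaSum_ne_zero hq0 hq one_ne_zero (by simpa) (by simpa)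
  have hR := ((((tendsto_sin_mul_div 2).const_mul (q * qPoch (q ^ 2) (q ^ 2) ^ 2)).mul
    (hA.mul hB)).mul hT1).div hT2 hne
  have heq := tendsto_nhds_unique_of_eventuallyEq hL hR ?_
  · have hsum : Summable fun n : ℕ+ => (n : ℂ) * lambert10 q n := by
      refine Summable.of_norm_bounded hb fun n => ?_
      rw [norm_mul, norm_natCast]
      gcongr
      linarith [show (0 : ℝ) ≤ (n : ℕ) by positivity]
    have h2 : ∑' n : ℕ+, lambert10 q n * ((2 * n : ℝ) : ℂ) =
        2 * ∑' n : ℕ+, (n : ℂ) * lambert10 q n := by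
      rw [← tsum_mul_left]
      refine tsum_congr fun n => ?_
      push_cast
      ring
    rw [h2, thetaSum_one hq0 hq, thetaSum_one hp0 hp] at heq
    convert hsum.hasSum using 1
    have h1 := qPoch_ne_zero_of_norm_lt hq hq
    have h2 := qPoch_ne_zero_of_norm_lt (norm_pow_lt_one hq two_ne_zero)
      (norm_pow_lt_one hq two_ne_zero)
    have h10 := qPoch_ne_zero_of_norm_lt hQ hQ
    apply mul_left_cancel₀ (two_ne_zero (α := ℂ))
    rw [heq]
    simp only [← pow_mul, Nat.reduceMul]
    push_cast
    field_simp
  · filter_upwards [self_mem_nhdsWithin] with t ht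
    have h := (hasSum_lambert10_mul_sin_real hq0 hq t).div_const (t : ℂ)
    have h' : HasSum (fun n : ℕ+ => lambert10 q n * (Complex.sin ((2 * n : ℝ) * t) / t)) _ :=
      h.congr_fun fun n => by push_cast; ring
    rw [h'.tsum_eq]
    simp only [Function.comp_apply, Pi.div_apply, ofReal_ofNat]
    ring

/-- Sum ψ(n) m q^{nm} in two orders: over m first it gives ψ(n) q^n/(1 - q^n)², over n first it
gives m times the Lambert coefficient. -/
theorem hasSum_psi10_mul (hq0 : q ≠ 0) (hq : ‖q‖ < 1) :
    HasSum (fun n : ℕ+ => psi10 ((n : ℕ) : ZMod 10) * (q ^ (n : ℕ) / (1 - q ^ (n : ℕ)) ^ 2))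
      (q * qPoch (q ^ 2) (q ^ 2) ^ 3 * qPoch (q ^ 5) (q ^ 5) ^ 2 * qPoch (q ^ 10) (q ^ 10) /
        qPoch q q ^ 2) := by
  have hs : Summable fun c : ℕ+ × ℕ+ =>
      psi10 ((c.1 : ℕ) : ZMod 10) * ((c.2 : ℂ) * q ^ (c.1 * c.2 : ℕ)) := by
    refine Summable.of_norm_bounded (summable_prod_mul_pow (𝕜 := ℂ) 1 hq).norm fun c => ?_
    rw [norm_mul, pow_one]
    exact mul_le_of_le_one_left (norm_nonneg _) (DirichletCharacter.norm_le_one _ _)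
  have hn : ∀ n : ℕ+, HasSum (fun m : ℕ+ =>
      psi10 ((n : ℕ) : ZMod 10) * ((m : ℂ) * q ^ (n * m : ℕ)))
      (psi10 ((n : ℕ) : ZMod 10) * (q ^ (n : ℕ) / (1 - q ^ (n : ℕ)) ^ 2)) := fun n => by
    have h := hasSum_coe_mul_geometric_of_norm_lt_one (norm_pow_lt_one hq n.ne_zero)
    refine (hasSum_of_eq (hasSum_pnat_of_hasSum_nat ?_ h) (fun m => ?_) rfl).mul_left _
    · simp
    · rw [pow_mul]
  have hm : ∀ m : ℕ+, HasSum (fun n : ℕ+ =>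
      psi10 ((n : ℕ) : ZMod 10) * ((m : ℂ) * q ^ (n * m : ℕ))) ((m : ℂ) * lambert10 q m) :=
    fun m => by
    have h := hasSum_psi10_mul_pow (norm_pow_lt_one hq m.ne_zero)
    have h0 : psi10 ((0 : ℕ) : ZMod 10) * (q ^ (m : ℕ)) ^ 0 = 0 := by rw [psi10_natCast]; simp
    refine hasSum_of_eq ((hasSum_pnat_of_hasSum_nat h0 h).mul_left (m : ℂ)) (fun n => ?_) ?_
    · rw [mul_comm (n : ℕ), pow_mul]
      ring
    · simp only [lambert10, ← pow_mul, mul_comm (m : ℕ)]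
  have hsum := hs.hasSum
  have h1 := hsum.prod_fiberwise hn
  have h2 := ((Equiv.prodComm ℕ+ ℕ+).hasSum_iff.2 hsum).prod_fiberwise hm
  rwa [h2.unique (hasSum_nat_mul_lambert10 hq0 hq)] at h1

end Derivative

end LambertTheta

end

/-! ### Assembly in the variables τ and z. -/

theorem mainTheorem10 :
    -- the character `psi10`: its values, and that it is not primitive
    (∀ n : ℤ, LambertTheta.psi10 (n : ZMod 10) =
      if n % 10 = 1 ∨ n % 10 = 9 then 1 else if n % 10 = 3 ∨ n % 10 = 7 then -1 else 0) ∧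
    ¬ LambertTheta.psi10.IsPrimitive ∧
    ∀ τ q : ℂ, 0 < τ.im → q = LambertTheta.nome τ →
      -- the identity in `z`, on the strip where the series converges
      (∀ z : ℂ, |z.im| < Real.pi * τ.im →
        LambertTheta.theta4 z (2 * τ) ≠ 0 ∧
        HasSum (fun n : ℕ+ => LambertTheta.lambert10 q n * Complex.sin (2 * (n : ℂ) * z))
          (ModularForm.eta (2 * τ) ^ 2 * LambertTheta.theta1 (2 * z) (10 * τ) *
              LambertTheta.theta4 z (10 * τ) /
            (2 * ModularForm.eta (10 * τ) * LambertTheta.theta4 z (2 * τ)))) ∧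
      -- the limit `z → 0`, in both forms
      HasSum (fun n : ℕ+ => (n : ℂ) * LambertTheta.lambert10 q n)
        (q * LambertTheta.qPoch (q ^ 2) (q ^ 2) ^ 3 * LambertTheta.qPoch (q ^ 5) (q ^ 5) ^ 2 *
            LambertTheta.qPoch (q ^ 10) (q ^ 10) /
          LambertTheta.qPoch q q ^ 2) ∧
      HasSum (fun n : ℕ+ => LambertTheta.psi10 ((n : ℕ) : ZMod 10) * (q ^ (n : ℕ) /
          (1 - q ^ (n : ℕ)) ^ 2))
        (q * LambertTheta.qPoch (q ^ 2) (q ^ 2) ^ 3 * LambertTheta.qPoch (q ^ 5) (q ^ 5) ^ 2 *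
            LambertTheta.qPoch (q ^ 10) (q ^ 10) /
          LambertTheta.qPoch q q ^ 2) ∧
      -- `z = π / 3`
      HasSum (fun n : ℕ+ => ((legendreSym 3 (n : ℕ) : ℤ) : ℂ) * LambertTheta.lambert10 q n)
        (q * LambertTheta.qPoch q q * LambertTheta.qPoch (q ^ 6) (q ^ 6) *
            LambertTheta.qPoch (q ^ 10) (q ^ 10) * LambertTheta.qPoch (q ^ 15) (q ^ 15) /
          (LambertTheta.qPoch (q ^ 3) (q ^ 3) * LambertTheta.qPoch (q ^ 5) (q ^ 5))) ∧
      -- `z = π / 4`; `ZMod.χ₄` is the Kronecker symbol `(-4 / ·)`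
      HasSum (fun n : ℕ+ => ((ZMod.χ₄ ((n : ℕ) : ZMod 4) : ℤ) : ℂ) * LambertTheta.lambert10 q n)
        (q * LambertTheta.qPoch (q ^ 2) (q ^ 2) ^ 2 * LambertTheta.qPoch (q ^ 8) (q ^ 8) *
            LambertTheta.qPoch (q ^ 20) (q ^ 20) ^ 4 /
          (LambertTheta.qPoch (q ^ 4) (q ^ 4) ^ 2 * LambertTheta.qPoch (q ^ 10) (q ^ 10) ^ 2 *
            LambertTheta.qPoch (q ^ 40) (q ^ 40))) := by
  refine ⟨LambertTheta.psi10_intCast, LambertTheta.not_isPrimitive_psi10, ?_⟩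
  intro τ q hτ hqτ
  have hq0 : q ≠ 0 := by rw [hqτ]; exact exp_ne_zero _
  have hnorm : ‖q‖ = Real.exp (-(2 * Real.pi * τ.im)) := by
    rw [hqτ, LambertTheta.nome, norm_exp]
    congr 1
    simp
  have hq : ‖q‖ < 1 := by
    rw [hnorm, Real.exp_lt_one_iff]
    have := mul_pos Real.pi_pos hτ
    linarith
  refine ⟨fun z hz => ?_, LambertTheta.hasSum_nat_mul_lambert10 hq0 hq,
    LambertTheta.hasSum_psi10_mul hq0 hq, LambertTheta.hasSum_legendreSym_mul_lambert10 hq0 hq,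
    LambertTheta.hasSum_chi_four_mul_lambert10 hq0 hq⟩
  have hxn : ‖cexp (2 * I * z)‖ = Real.exp (-(2 * z.im)) := by
    rw [norm_exp]
    congr 1
    simp
  obtain ⟨hz1, hz2⟩ := abs_lt.1 hz
  have hx1 : ‖q * cexp (2 * I * z)‖ < 1 := by
    rw [norm_mul, hnorm, hxn, ← Real.exp_add, Real.exp_lt_one_iff]
    linarith
  have hx2 : ‖q * (cexp (2 * I * z))⁻¹‖ < 1 := by
    rw [norm_mul, norm_inv, hnorm, hxn, ← Real.exp_neg, ← Real.exp_add, Real.exp_lt_one_iff]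
    linarith
  have hτ2 : 0 < (2 * τ).im := by simpa using hτ
  have hτ10 : 0 < (10 * τ).im := by simpa using hτ
  have e2 : cexp (Real.pi * I * (2 * τ)) = q := by
    rw [hqτ, LambertTheta.nome]; congr 1; ring
  have e10 : cexp (Real.pi * I * (10 * τ)) = q ^ 5 := by
    rw [hqτ, LambertTheta.nome, ← exp_nat_mul]; congr 1; push_cast; ring
  have n2 : LambertTheta.nome (2 * τ) = q ^ 2 := by
    rw [hqτ, LambertTheta.nome, LambertTheta.nome, ← exp_nat_mul]; congr 1; push_cast; ring
  have n10 : LambertTheta.nome (10 * τ) = q ^ 10 := by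
    rw [hqτ, LambertTheta.nome, LambertTheta.nome, ← exp_nat_mul]; congr 1; push_cast; ring
  have hT := LambertTheta.thetaSum_ne_zero hq0 hq (exp_ne_zero _) hx1 hx2
  have h4 : LambertTheta.theta4 z (2 * τ) = LambertTheta.thetaSum q (cexp (2 * I * z)) := by
    rw [LambertTheta.theta4_eq_thetaSum hτ2, e2]
  refine ⟨h4 ▸ hT, ?_⟩
  have hQ : ‖q ^ 10‖ < 1 := LambertTheta.norm_pow_lt_one hq (by norm_num)
  have hE := LambertTheta.qPoch_ne_zero_of_norm_lt hQ hQ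
  convert LambertTheta.hasSum_lambert10_mul_sin hq0 hq hx1 hx2 using 1
  rw [h4, LambertTheta.theta4_eq_thetaSum hτ10, LambertTheta.theta1_eq_thetaSum hτ10, e10,
    LambertTheta.eta_eq_qPoch, LambertTheta.eta_eq_qPoch, n2, n10,
    show I * (2 * z) = 2 * I * z by ring]
  -- The fractional powers of q balance: 2·(2/24) + 10/8 = 1 + 10/24.
  have hexp : cexp (2 * Real.pi * I * (2 * τ) / 24) ^ 2 *
      cexp (2 * Real.pi * I * (10 * τ) / 8) = q * cexp (2 * Real.pi * I * (10 * τ) / 24) := by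
    rw [hqτ, LambertTheta.nome, ← exp_nat_mul, ← exp_add, ← exp_add]
    congr 1
    push_cast
    ring
  have hx := exp_ne_zero (2 * Real.pi * I * (10 * τ) / 24)
  rw [div_eq_div_iff (by simp [hx, hE, hT]) (by simp [hE, hT])]
  generalize LambertTheta.thetaSum (q ^ 5) (q ^ 5 * cexp (2 * I * z) ^ 2) = T at *
  generalize LambertTheta.thetaSum (q ^ 5) (cexp (2 * I * z)) = T' at *
  generalize LambertTheta.thetaSum q (cexp (2 * I * z)) = T'' at *
  generalize LambertTheta.qPoch (q ^ 10) (q ^ 10) = A at *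
  generalize LambertTheta.qPoch (q ^ 2) (q ^ 2) = B at *
  linear_combination (-I * 2 * B ^ 2 * cexp (2 * I * z) * T * T' * A * T'') * hexp
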